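/- Let $\ell\in\mathbb Z_{\ge 0}$ and let $\Pi^+=\{z\in\mathbb C:\operatorname{Re}z>0\}$. Let $\mathcal A_\ell$ be the Hilbert space of analytic functions $h:\Pi^+\to\mathbb C$ with $$\|h\|^2=\frac1\pi\int_{-\infty}^{\infty}\int_0^\infty x^\ell|h(x+iy)|^2\,dx\,dy<\infty .$$ Define the anti-linear operator $\mathcal C_\star:\mathcal A_\ell\to\mathcal A_\ell$ by $(\mathcal C_\star h)(z)=z^{-(\ell+2)}\,\overline{h(1/\overline z)}$. Let $f:\Pi^+\to\mathbb C$ and $g:\Pi^+\to\Pi^+$ be analytic. Let $W_{f,g,\max}$ be the operator $h\mapsto f\cdot(h\circ g)$ with domain $\{h\in\mathcal A_\ell: f\cdot(h\circ g)\in\mathcal A_\ell\}$, and let $W_{f,g}$ be any linear operator on $\mathcal A_\ell$ with $W_{f,g}\preceq W_{f,g,\max}$ (that is, a restriction of $W_{f,g,\max}$ to a linear subspace of its domain). The operator $W_{f,g}$ is called $\mathcal C_\star$-selfadjoint if it is densely defined and $W_{f,g}=\mathcal C_\star W_{f,g}^*\mathcal C_\star$ (with equality of domains), and bounded if its domain is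 $\mathcal A_\ell$ and $\|W_{f,g}h\|\le L\|h\|$ for all $h$, with some constant $L>0$. Then $W_{f,g}$ is $\mathcal C_\star$-selfadjoint if and only if both of the following conditions hold. 1. $W_{f,g}$ is maximal: $W_{f,g}=W_{f,g,\max}$. 2. Either $f\equiv 0$ on $\Pi^+$, or $(f,g)$ has one of the following three forms on $\Pi^+$: * $g(w)=\alpha$, $f(w)=\dfrac{\beta}{(1+\alpha w)^{\ell+2}}$, where $\alpha\in\Pi^+$ and $\beta\in\mathbb C$; * $g(w)=\lambda w$, $f(w)=\theta$, where $\lambda\in\mathbb R$, $\lambda>0$, and $\theta\in\mathbb C$; * $g(w)=\delta+\dfrac{1-\delta\kappa}{w+\kappa}$, $f(w)=\dfrac{r}{(w+\kappa)^{\ell+2}}$, where $\delta,\kappa,r\in\mathbb C$ satisfy either $\delta\in i\mathbb R$, $\delta\kappa\in\mathbb R$, $\delta\kappa<1$, $\operatorname{Re}\kappa\ge 0$, or $$-\operatorname{Re}\delta<0\le\operatorname{Re}\kappa-\frac{\operatorname{Re}(\delta\kappa-1)+|\delta\kappa-1|}{2\operatorname{Re}\delta}.$$ In this case, $W_{f,g}$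 is bounded. -/

import Mathlib

noncomputable section

open MeasureTheory Set Filter Topology
open scoped ComplexConjugate ENNReal InnerProductSpace

namespace HalfPlane

/-- The open right half-plane `{z : ℂ | 0 < Re z}`, as a set. -/
def rhp : Set ℂ := {z : ℂ | 0 < z.re}

/-- The open right half-plane, as a type. -/
abbrev RHP : Type := {z : ℂ // 0 < z.re}

/-- A function on the right half-plane is analytic if it is the restriction of a function
`ℂ → ℂ` which is analytic at every point of the half-plane. -/
def IsAnalytic (h : RHP → ℂ) : Prop :=
  ∃ F : ℂ → ℂ, AnalyticOnNhd ℂ F rhp ∧ ∀ z : RHP, h z = F z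

/-- The measure `(1/π) x^ℓ dx dy` on the right half-plane. -/
def bergmanMeasure (l : ℕ) : Measure RHP :=
  (Measure.comap ((↑) : RHP → ℂ) volume).withDensity
    fun z => ENNReal.ofReal ((z : ℂ).re ^ l / Real.pi)

theorem isOpen_rhp : IsOpen rhp := isOpen_lt continuous_const Complex.continuous_re

theorem measurableSet_rhp : MeasurableSet rhp := isOpen_rhp.measurableSet

theorem measurable_weight (l : ℕ) :
    Measurable fun z : ℂ => ENNReal.ofReal (z.re ^ l / Real.pi) := by fun_prop

theorem lintegral_bergmanMeasure (l : ℕ) (G : ℂ → ℝ≥0∞) :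
    ∫⁻ z : RHP, G z ∂(bergmanMeasure l)
      = ∫⁻ z in rhp, ENNReal.ofReal (z.re ^ l / Real.pi) * G z := by
  rw [bergmanMeasure, lintegral_withDensity_eq_lintegral_mul_non_measurable]
  · exact lintegral_subtype_comap measurableSet_rhp
      (fun z : ℂ => ENNReal.ofReal (z.re ^ l / Real.pi) * G z)
  · exact (measurable_weight l).comp measurable_subtype_coe
  · exact ae_of_all _ fun _ => ENNReal.ofReal_lt_top

theorem IsAnalytic.continuous {h : RHP → ℂ} (hh : IsAnalytic h) : Continuous h := by
  obtain ⟨F, hF, e⟩ := hh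
  rw [funext e]
  exact continuousOn_iff_continuous_domRestrict.1 hF.continuousOn

theorem memLp_two_iff {h : RHP → ℂ} (hh : Continuous h) (l : ℕ) :
    MemLp h 2 (bergmanMeasure l) ↔ ∫⁻ z, ‖h z‖ₑ ^ 2 ∂(bergmanMeasure l) < ∞ := by
  rw [MemLp, and_iff_right hh.aestronglyMeasurable,
    eLpNorm_lt_top_iff_lintegral_rpow_enorm_lt_top (by norm_num) (by norm_num)]
  norm_num

theorem IsAnalytic.add {h k : RHP → ℂ} (hh : IsAnalytic h) (hk : IsAnalytic k) :
    IsAnalytic (h + k) := by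
  obtain ⟨F, hF, e⟩ := hh
  obtain ⟨G, hG, e'⟩ := hk
  exact ⟨F + G, hF.add hG, fun z => by simp [e, e']⟩

theorem IsAnalytic.smul {h : RHP → ℂ} (c : ℂ) (hh : IsAnalytic h) : IsAnalytic (c • h) := by
  obtain ⟨F, hF, e⟩ := hh
  exact ⟨fun z => c * F z, analyticOnNhd_const.mul hF, fun z => by simp [e]⟩

/-- The weighted Bergman space, as a space of functions on the right half-plane: the analytic
functions `h` with `(1/π) ∫∫ x^ℓ |h(x + iy)|² dx dy < ∞`. -/
def bergmanSubmodule (l : ℕ) : Submodule ℂ (RHP → ℂ) where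
  carrier := {h | IsAnalytic h ∧ MemLp h 2 (bergmanMeasure l)}
  zero_mem' := ⟨⟨0, analyticOnNhd_const, fun _ => rfl⟩, MemLp.zero⟩
  add_mem' ha hb := ⟨ha.1.add hb.1, ha.2.add hb.2⟩
  smul_mem' c _ ha := ⟨ha.1.smul c, ha.2.const_smul c⟩

/-- The weighted Bergman space of the right half-plane. -/
def Bergman (l : ℕ) : Type := ↥(bergmanSubmodule l)

namespace Bergman

variable {l : ℕ}

instance : AddCommGroup (Bergman l) := inferInstanceAs (AddCommGroup ↥(bergmanSubmodule l))

instance : Module ℂ (Bergman l) := inferInstanceAs (Module ℂ ↥(bergmanSubmodule l))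

instance : FunLike (Bergman l) RHP ℂ where
  coe := Subtype.val
  coe_injective := Subtype.val_injective

/-- An analytic square-integrable function, as an element of the Bergman space. -/
def mk (h : RHP → ℂ) (hh : h ∈ bergmanSubmodule l) : Bergman l := ⟨h, hh⟩

@[simp] theorem mk_apply (h : RHP → ℂ) (hh : h ∈ bergmanSubmodule l) (z : RHP) :
    mk h hh z = h z := rfl

@[simp] theorem add_apply (h k : Bergman l) (z : RHP) : (h + k) z = h z + k z := rfl

@[simp] theorem smul_apply (c : ℂ) (h : Bergman l) (z : RHP) : (c • h) z = c * h z := rfl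

@[simp] theorem zero_apply (z : RHP) : (0 : Bergman l) z = 0 := rfl

@[simp] theorem sub_apply (h k : Bergman l) (z : RHP) : (h - k) z = h z - k z := rfl

@[ext] theorem ext {h k : Bergman l} (H : ∀ z, h z = k z) : h = k := DFunLike.ext h k H

theorem analytic (h : Bergman l) : IsAnalytic h := h.2.1

theorem memLp (h : Bergman l) : MemLp h 2 (bergmanMeasure l) := h.2.2

theorem eq_zero_of_ae {h : Bergman l} (H : ∀ᵐ z ∂(bergmanMeasure l), h z = 0) : h = 0 := by
  obtain ⟨F, hF, e⟩ := h.analytic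
  have h1 : ∀ᵐ z ∂(volume.restrict rhp), F z = 0 := by
    rw [bergmanMeasure, ae_withDensity_iff (by fun_prop)] at H
    rw [← map_comap_subtype_coe measurableSet_rhp,
      (MeasurableEmbedding.subtype_coe measurableSet_rhp).ae_map_iff]
    refine H.mono fun z hz => ?_
    rw [← e z]
    refine hz ?_
    have : 0 < (z : ℂ).re := z.2
    have := Real.pi_pos
    simp only [ne_eq, ENNReal.ofReal_eq_zero, not_le]
    positivity
  have h2 := Measure.eqOn_open_of_ae_eq (f := F) (g := fun _ => (0 : ℂ)) h1 isOpen_rhp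
    hF.continuousOn continuousOn_const
  ext z
  rw [e z]
  exact h2 z.2

/-- The class of a Bergman function in `L²`. -/
def toLp : Bergman l →ₗ[ℂ] Lp ℂ 2 (bergmanMeasure l) where
  toFun h := h.memLp.toLp h
  map_add' _ _ := rfl
  map_smul' _ _ := rfl

/-- The inner product `⟪h, k⟫ = (1/π) ∫∫ x^ℓ conj(h) k dx dy` (conjugate-linear in the first
variable). -/
def ip (h k : Bergman l) : ℂ := ∫ z, conj (h z) * k z ∂(bergmanMeasure l)

theorem ip_eq_inner_toLp (h k : Bergman l) : ip h k = ⟪toLp h, toLp k⟫_ℂ := by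
  rw [ip, L2.inner_def]
  refine integral_congr_ae ?_
  filter_upwards [h.memLp.coeFn_toLp, k.memLp.coeFn_toLp] with z hz hz'
  change _ = ⟪(h.memLp.toLp h) z, (k.memLp.toLp k) z⟫_ℂ
  rw [hz, hz', RCLike.inner_apply, mul_comm]

theorem toLp_eq_zero {h : Bergman l} (H : toLp h = 0) : h = 0 := by
  refine eq_zero_of_ae ?_
  have h1 : (h.memLp.toLp h : RHP → ℂ) =ᵐ[bergmanMeasure l] 0 := by
    have : h.memLp.toLp h = 0 := H
    rw [this]
    exact Lp.coeFn_zero _ _ _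
  filter_upwards [h.memLp.coeFn_toLp, h1] with z hz hz'
  rw [← hz, hz']
  rfl

/-- The inner product of the Bergman space satisfies the axioms of an inner product. -/
@[reducible] def innerCore : InnerProductSpace.Core ℂ (Bergman l) where
  inner := ip
  conj_inner_symm h k := by
    simp only [ip_eq_inner_toLp]
    exact inner_conj_symm _ _
  re_inner_nonneg h := by
    simp only [ip_eq_inner_toLp]
    exact inner_self_nonneg
  add_left h k m := by
    simp only [ip_eq_inner_toLp, map_add, inner_add_left]
  smul_left h k c := by
    simp only [ip_eq_inner_toLp, map_smul, inner_smul_left]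
  definite h hh := by
    rw [ip_eq_inner_toLp, inner_self_eq_zero] at hh
    exact toLp_eq_zero hh

instance : NormedAddCommGroup (Bergman l) := innerCore.toNormedAddCommGroup

instance : InnerProductSpace ℂ (Bergman l) := .ofCore innerCore.toCore

theorem inner_def (h k : Bergman l) : ⟪h, k⟫_ℂ = ∫ z, conj (h z) * k z ∂(bergmanMeasure l) := rfl

theorem inner_eq_inner_toLp (h k : Bergman l) : ⟪h, k⟫_ℂ = ⟪toLp h, toLp k⟫_ℂ :=
  ip_eq_inner_toLp h k

theorem norm_toLp (h : Bergman l) : ‖toLp h‖ = ‖h‖ := by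
  rw [@norm_eq_sqrt_re_inner ℂ, @norm_eq_sqrt_re_inner ℂ, ← inner_eq_inner_toLp]

/-- Bergman space sits isometrically in `L²`. -/
def toLpIso : Bergman l →ₗᵢ[ℂ] Lp ℂ 2 (bergmanMeasure l) := ⟨toLp, norm_toLp⟩

theorem lintegral_enorm_sq (h : Bergman l) :
    ∫⁻ z, ‖h z‖ₑ ^ 2 ∂(bergmanMeasure l) = ‖h‖ₑ ^ 2 := by
  have h1 : ‖h‖ₑ = eLpNorm h 2 (bergmanMeasure l) := by
    rw [← Lp.enorm_toLp h.memLp, ← ofReal_norm, ← ofReal_norm, ← norm_toLp]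
    rfl
  rw [h1, eLpNorm_eq_lintegral_rpow_enorm_toReal (by norm_num) (by norm_num),
    ← ENNReal.rpow_natCast, ← ENNReal.rpow_mul]
  norm_num


end Bergman

/-- Mean value inequality on circles for the squared modulus of an analytic function. -/
theorem sq_norm_le_circle {F : ℂ → ℂ} {c : ℂ} {r : ℝ} (hr : 0 < r)
    (hF : DifferentiableOn ℂ F (Metric.closedBall c r)) :
    ENNReal.ofReal (2 * Real.pi) * ‖F c‖ₑ ^ 2
      ≤ ∫⁻ θ in Ioo (-Real.pi) Real.pi, ‖F (circleMap c r θ)‖ₑ ^ 2 := by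
  have h1 : DiffContOnCl ℂ (fun z => F z ^ 2) (Metric.ball c |r|) := by
    rw [abs_of_pos hr]
    refine DifferentiableOn.diffContOnCl ?_
    rw [closure_ball c hr.ne']
    exact hF.pow 2
  have h2 := h1.circleAverage
  rw [Real.circleAverage_eq_integral_add (-Real.pi),
    intervalIntegral.integral_comp_add_right (fun θ => F (circleMap c r θ) ^ 2),
    inv_smul_eq_iff₀ (by positivity)] at h2
  have h3 : (0 : ℝ) + -Real.pi = -Real.pi := by ring
  have h4 : 2 * Real.pi + -Real.pi = Real.pi := by ring
  rw [h3, h4, intervalIntegral.integral_of_le (by linarith [Real.pi_pos]),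
    integral_Ioc_eq_integral_Ioo] at h2
  have h5 := enorm_integral_le_lintegral_enorm
    (μ := volume.restrict (Ioo (-Real.pi) Real.pi)) (fun θ => F (circleMap c r θ) ^ 2)
  rw [h2, enorm_smul, enorm_pow, Real.enorm_of_nonneg (by positivity)] at h5
  simpa only [enorm_pow] using h5

/-- Mean value inequality on discs for the squared modulus of an analytic function. -/
theorem sq_norm_le_ball {F : ℂ → ℂ} {c : ℂ} {r : ℝ} (hr : 0 < r)
    (hF : DifferentiableOn ℂ F (Metric.ball c r)) :
    ENNReal.ofReal (Real.pi * r ^ 2) * ‖F c‖ₑ ^ 2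
      ≤ ∫⁻ z in Metric.ball c r, ‖F z‖ₑ ^ 2 := by
  set G : ℂ → ℝ≥0∞ := (Metric.ball c r).indicator fun z => ‖F z‖ₑ ^ 2 with hG
  have hmap : ∀ p : ℝ × ℝ, c + Complex.polarCoord.symm p = circleMap c p.1 p.2 := fun p => by
    rw [Complex.polarCoord_symm_apply, circleMap, Complex.exp_mul_I]
    push_cast
    ring
  have hin : ∀ p ∈ Ioo (0 : ℝ) r ×ˢ Ioo (-Real.pi) Real.pi,
      circleMap c p.1 p.2 ∈ Metric.ball c r := fun p hp => by
    rw [Metric.mem_ball, dist_eq_norm, circleMap_sub_center, norm_circleMap_zero,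
      abs_of_pos hp.1.1]
    exact hp.1.2
  have hms : MeasurableSet (Ioo (0 : ℝ) r ×ˢ Ioo (-Real.pi) Real.pi) :=
    measurableSet_Ioo.prod measurableSet_Ioo
  have hcont : ContinuousOn (fun p : ℝ × ℝ =>
      ENNReal.ofReal p.1 * ‖F (circleMap c p.1 p.2)‖ₑ ^ 2)
      (Ioo (0 : ℝ) r ×ˢ Ioo (-Real.pi) Real.pi) := by
    have hc : ContinuousOn (fun p : ℝ × ℝ => F (circleMap c p.1 p.2))
        (Ioo (0 : ℝ) r ×ˢ Ioo (-Real.pi) Real.pi) := by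
      refine hF.continuousOn.comp (t := Metric.ball c r) ?_ hin
      refine Continuous.continuousOn ?_
      unfold circleMap
      fun_prop
    have h1 : ContinuousOn (fun p : ℝ × ℝ =>
        ENNReal.ofReal (p.1 * ‖F (circleMap c p.1 p.2)‖ ^ 2))
        (Ioo (0 : ℝ) r ×ˢ Ioo (-Real.pi) Real.pi) :=
      ENNReal.continuous_ofReal.comp_continuousOn (continuousOn_fst.mul (hc.norm.pow 2))
    refine h1.congr fun p hp => ?_
    simp only
    rw [ENNReal.ofReal_mul hp.1.1.le, ENNReal.ofReal_pow (norm_nonneg _), ofReal_norm]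
  have hrad : ∫⁻ ρ in Ioo (0 : ℝ) r, ENNReal.ofReal ρ = ENNReal.ofReal (r ^ 2 / 2) := by
    rw [← ofReal_integral_eq_lintegral_ofReal]
    · rw [← integral_Ioc_eq_integral_Ioo, ← intervalIntegral.integral_of_le hr.le, integral_id]
      simp
    · exact (continuous_id.integrableOn_Icc (a := 0) (b := r)).mono_set Ioo_subset_Icc_self
    · exact (ae_restrict_iff' measurableSet_Ioo).2 (ae_of_all _ fun ρ hρ => hρ.1.le)
  calc ENNReal.ofReal (Real.pi * r ^ 2) * ‖F c‖ₑ ^ 2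
      = ∫⁻ ρ in Ioo (0 : ℝ) r,
          ENNReal.ofReal ρ * (ENNReal.ofReal (2 * Real.pi) * ‖F c‖ₑ ^ 2) := by
        rw [lintegral_mul_const' _ _ (by finiteness), hrad, ← mul_assoc,
          ← ENNReal.ofReal_mul (by positivity)]
        congr 2
        ring
    _ ≤ ∫⁻ ρ in Ioo (0 : ℝ) r, ∫⁻ θ in Ioo (-Real.pi) Real.pi,
          ENNReal.ofReal ρ * ‖F (circleMap c ρ θ)‖ₑ ^ 2 := by
        refine setLIntegral_mono' measurableSet_Ioo fun ρ hρ => ?_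
        rw [lintegral_const_mul' _ _ ENNReal.ofReal_ne_top]
        gcongr
        exact sq_norm_le_circle hρ.1
          (hF.mono (Metric.closedBall_subset_ball hρ.2))
    _ = ∫⁻ p in Ioo (0 : ℝ) r ×ˢ Ioo (-Real.pi) Real.pi,
          ENNReal.ofReal p.1 * ‖F (circleMap c p.1 p.2)‖ₑ ^ 2 := by
        rw [Measure.volume_eq_prod, ← Measure.prod_restrict, lintegral_prod]
        rw [Measure.prod_restrict, ← Measure.volume_eq_prod]
        exact hcont.aemeasurable hms
    _ = ∫⁻ p in Ioo (0 : ℝ) r ×ˢ Ioo (-Real.pi) Real.pi,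
          ENNReal.ofReal p.1 • G (c + Complex.polarCoord.symm p) := by
        refine setLIntegral_congr_fun hms fun p hp => ?_
        simp only [hG, hmap, smul_eq_mul, indicator_of_mem (hin p hp)]
    _ ≤ ∫⁻ p in Complex.polarCoord.target,
          ENNReal.ofReal p.1 • G (c + Complex.polarCoord.symm p) :=
        lintegral_mono_set (prod_mono Ioo_subset_Ioi_self subset_rfl)
    _ = ∫⁻ z, G z := by
        refine (Complex.lintegral_comp_polarCoord_symm (fun z => G (c + z))).trans ?_
        exact lintegral_add_left_eq_self G c
    _ = ∫⁻ z in Metric.ball c r, ‖F z‖ₑ ^ 2 := lintegral_indicator measurableSet_ball _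

namespace Bergman

variable {l : ℕ}

/-- Point evaluations are bounded, uniformly on half-planes `Re z > 2 r`. -/
theorem exists_bound (l : ℕ) {r : ℝ} (hr : 0 < r) :
    ∃ C : ℝ, ∀ (h : Bergman l) (z : RHP), 2 * r < (z : ℂ).re → ‖h z‖ ≤ C * ‖h‖ := by
  set A : ℝ := Real.pi * r ^ 2 * (r ^ l / Real.pi) with hA
  have hApos : 0 < A := by positivity
  refine ⟨√(A⁻¹), fun h z hz => ?_⟩
  obtain ⟨F, hF, e⟩ := h.analytic
  have hsub : ∀ w ∈ Metric.ball (z : ℂ) r, r < w.re := fun w hw => by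
    have h1 := Complex.abs_re_le_norm (w - z)
    rw [Metric.mem_ball, dist_eq_norm] at hw
    have h2 := neg_abs_le (w - z).re
    rw [Complex.sub_re] at h1 h2
    linarith
  have h1 := sq_norm_le_ball (c := (z : ℂ)) hr
    (hF.differentiableOn.mono fun w hw => hr.trans (hsub w hw))
  have h2 : ENNReal.ofReal A * ‖h z‖ₑ ^ 2 ≤ ‖h‖ₑ ^ 2 := by
    rw [← lintegral_enorm_sq]
    simp only [e]
    rw [lintegral_bergmanMeasure l (fun z => ‖F z‖ₑ ^ 2), hA, mul_comm,
      ENNReal.ofReal_mul (by positivity), ← mul_assoc, mul_comm (‖F z‖ₑ ^ 2), mul_comm]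
    calc _ ≤ ENNReal.ofReal (r ^ l / Real.pi) * ∫⁻ z in Metric.ball (z : ℂ) r, ‖F z‖ₑ ^ 2 := by
          gcongr
      _ = ∫⁻ z in Metric.ball (z : ℂ) r, ENNReal.ofReal (r ^ l / Real.pi) * ‖F z‖ₑ ^ 2 :=
          (lintegral_const_mul' _ _ ENNReal.ofReal_ne_top).symm
      _ ≤ ∫⁻ z in Metric.ball (z : ℂ) r,
            ENNReal.ofReal (z.re ^ l / Real.pi) * ‖F z‖ₑ ^ 2 := by
          refine setLIntegral_mono' measurableSet_ball fun w hw => ?_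
          have := hsub w hw
          gcongr
      _ ≤ _ := lintegral_mono_set fun w hw => hr.trans (hsub w hw)
  rw [← ofReal_norm, ← ofReal_norm, ← ENNReal.ofReal_pow (norm_nonneg _),
    ← ENNReal.ofReal_pow (norm_nonneg _), ← ENNReal.ofReal_mul hApos.le,
    ENNReal.ofReal_le_ofReal_iff (by positivity)] at h2
  rw [← abs_of_nonneg (norm_nonneg (h z)), ← abs_of_nonneg (norm_nonneg h),
    ← Real.sqrt_sq_eq_abs, ← Real.sqrt_sq_eq_abs, ← Real.sqrt_mul (by positivity)]
  refine Real.sqrt_le_sqrt ?_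
  rw [inv_mul_eq_div, le_div_iff₀ hApos]
  linarith

instance : CompleteSpace (Bergman l) := by
  refine Metric.complete_of_cauchySeq_tendsto fun u hu => ?_
  choose F hF e using fun n => (u n).analytic
  have hbd : ∀ r : ℝ, 0 < r →
      UniformCauchySeqOn F atTop {z : ℂ | 2 * r < z.re} := fun r hr => by
    obtain ⟨C, hC⟩ := exists_bound l hr
    rw [Metric.uniformCauchySeqOn_iff]
    intro ε hε
    obtain ⟨N, hN⟩ := Metric.cauchySeq_iff.1 hu (ε / (|C| + 1)) (by positivity)
    refine ⟨N, fun m hm n hn z hz => ?_⟩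
    have hz' : 0 < z.re := lt_trans (by positivity) (show 2 * r < z.re from hz)
    have h1 := hC (u m - u n) ⟨z, hz'⟩ hz
    rw [sub_apply, e, e, ← dist_eq_norm, ← dist_eq_norm] at h1
    have h2 := hN m hm n hn
    rw [lt_div_iff₀ (by positivity)] at h2
    have h3 : C * dist (u m) (u n) ≤ |C| * dist (u m) (u n) := by gcongr; exact le_abs_self C
    have h4 : 0 ≤ dist (u m) (u n) := dist_nonneg
    calc dist (F m z) (F n z) ≤ C * dist (u m) (u n) := h1
      _ < ε := by nlinarith
  have hpt : ∀ z : ℂ, 0 < z.re → ∃ y, Tendsto (fun n => F n z) atTop (𝓝 y) := fun z hz => by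
    have := (hbd (z.re / 4) (by positivity)).cauchySeq (x := z)
      (show 2 * (z.re / 4) < z.re by linarith)
    exact cauchySeq_tendsto_of_complete this
  have hG : ∃ G : ℂ → ℂ, ∀ z : ℂ, 0 < z.re → Tendsto (fun n => F n z) atTop (𝓝 (G z)) := by
    refine ⟨fun z => if hz : 0 < z.re then (hpt z hz).choose else 0, fun z hz => ?_⟩
    simp only [dif_pos hz]
    exact (hpt z hz).choose_spec
  obtain ⟨G, hG⟩ := hG
  have hloc : TendstoLocallyUniformlyOn F G atTop rhp := by
    refine tendstoLocallyUniformlyOn_of_forall_exists_nhds fun z hz => ?_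
    have hz' : 0 < z.re := hz
    refine ⟨{w : ℂ | 2 * (z.re / 4) < w.re}, mem_nhdsWithin_of_mem_nhds
      ((isOpen_lt continuous_const Complex.continuous_re).mem_nhds
        (show 2 * (z.re / 4) < z.re by linarith)), ?_⟩
    refine (hbd (z.re / 4) (by positivity)).tendstoUniformlyOn_of_tendsto fun w hw => hG w ?_
    exact lt_trans (by positivity) (show 2 * (z.re / 4) < w.re from hw)
  have hGd : DifferentiableOn ℂ G rhp :=
    hloc.differentiableOn (Eventually.of_forall fun n => (hF n).differentiableOn) isOpen_rhp
  have hcau : CauchySeq fun n => toLpIso (u n) := hu.map toLpIso.isometry.uniformContinuous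
  obtain ⟨v, hv⟩ := cauchySeq_tendsto_of_complete hcau
  obtain ⟨ns, hns, hae⟩ := (tendstoInMeasure_of_tendsto_Lp hv).exists_seq_tendsto_ae
  have hu' : ∀ᵐ z ∂(bergmanMeasure l), ∀ n, (toLpIso (u n) : RHP → ℂ) z = u n z :=
    ae_all_iff.2 fun n => (u n).memLp.coeFn_toLp
  have hvG : (v : RHP → ℂ) =ᵐ[bergmanMeasure l] fun z => G z := by
    filter_upwards [hae, hu'] with z hz hz'
    refine tendsto_nhds_unique hz ?_
    simp only [hz', e]
    exact (hG z z.2).comp hns.tendsto_atTop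
  have hmem : (fun z : RHP => G z) ∈ bergmanSubmodule l :=
    ⟨⟨G, hGd.analyticOnNhd isOpen_rhp, fun _ => rfl⟩, (memLp_congr_ae hvG).1 (Lp.memLp v)⟩
  refine ⟨mk _ hmem, ?_⟩
  rw [toLpIso.isometry.isEmbedding.tendsto_nhds_iff]
  convert! hv
  refine Lp.ext ?_
  exact ((mk _ hmem).memLp.coeFn_toLp).trans hvG.symm

end Bergman

/-- The map `z ↦ 1 / conj z` of the right half-plane. -/
def reflect (z : RHP) : RHP :=
  ⟨1 / conj (z : ℂ), by
    have hz : (z : ℂ) ≠ 0 := fun h => absurd z.2 (by simp [h])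
    have := Complex.normSq_pos.2 hz
    rw [one_div, Complex.inv_re, Complex.conj_re, Complex.normSq_conj]
    exact div_pos z.2 this⟩

theorem ne_zero_of_mem_rhp {z : ℂ} (hz : z ∈ rhp) : z ≠ 0 := by
  rintro rfl
  simp [rhp] at hz

/-- The expression `z ↦ z^{-(ℓ+2)} conj (h (1 / conj z))`. -/
def cstarFun (l : ℕ) (h : RHP → ℂ) : RHP → ℂ :=
  fun z => 1 / (z : ℂ) ^ (l + 2) * conj (h (reflect z))

theorem cstarFun_analytic {l : ℕ} {h : RHP → ℂ} (hh : IsAnalytic h) :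
    IsAnalytic (cstarFun l h) := by
  obtain ⟨F, hF, e⟩ := hh
  refine ⟨fun z => 1 / z ^ (l + 2) * conj (F (conj (1 / z))), ?_, fun z => ?_⟩
  · refine DifferentiableOn.analyticOnNhd (fun z hz => ?_) isOpen_rhp
    have hz0 := ne_zero_of_mem_rhp hz
    have hmem : conj (1 / z) ∈ rhp := by
      have := (reflect ⟨z, hz⟩).2
      simpa [reflect, rhp] using this
    have h1 : DifferentiableAt ℂ (conj ∘ F ∘ conj) (1 / z) := by
      rw [differentiableAt_conj_conj_iff]
      exact (hF _ hmem).differentiableAt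
    refine DifferentiableAt.differentiableWithinAt (DifferentiableAt.mul ?_ ?_)
    · exact (differentiableAt_const _).div (by fun_prop) (pow_ne_zero _ hz0)
    · exact h1.comp z ((differentiableAt_const _).div differentiableAt_id hz0)
  · simp [cstarFun, e, reflect]

theorem lintegral_cstarFun {l : ℕ} {h : RHP → ℂ} (hh : IsAnalytic h) :
    ∫⁻ z, ‖cstarFun l h z‖ₑ ^ 2 ∂(bergmanMeasure l) = ∫⁻ z, ‖h z‖ₑ ^ 2 ∂(bergmanMeasure l) := by
  obtain ⟨F, hF, e⟩ := hh
  set σ : ℂ → ℂ := fun z => conj z⁻¹ with hσ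
  have hσmem : ∀ z ∈ rhp, σ z ∈ rhp := fun z hz => by
    have := (reflect ⟨z, hz⟩).2
    simpa [reflect, rhp, hσ] using this
  have hσσ : ∀ z, σ (σ z) = z := fun z => by simp [hσ]
  have himg : σ '' rhp = rhp := by
    refine Subset.antisymm (image_subset_iff.2 hσmem) fun z hz => ⟨σ z, hσmem z hz, hσσ z⟩
  have hder : ∀ z ∈ rhp, HasFDerivWithinAt σ
      ((Complex.conjCLE : ℂ →L[ℝ] ℂ).comp
        ((ContinuousLinearMap.toSpanSingleton ℂ (-(z ^ 2)⁻¹)).restrictScalars ℝ)) rhp z :=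
    fun z hz => by
      have h1 : HasFDerivAt (fun z : ℂ => z⁻¹) _ z :=
        (hasDerivAt_inv (ne_zero_of_mem_rhp hz)).hasFDerivAt.restrictScalars ℝ
      exact (Complex.conjCLE.hasFDerivAt.comp z h1).hasFDerivWithinAt
  have hdet : ∀ z : ℂ, |((Complex.conjCLE : ℂ →L[ℝ] ℂ).comp
        ((ContinuousLinearMap.toSpanSingleton ℂ (-(z ^ 2)⁻¹)).restrictScalars ℝ)).det|
        = ‖z‖⁻¹ ^ 4 := fun z => by
    have h1 : ((ContinuousLinearMap.toSpanSingleton ℂ (-(z ^ 2)⁻¹)).restrictScalars ℝ).det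
        = Complex.normSq (-(z ^ 2)⁻¹) := by
      rw [← Algebra.norm_complex_apply]
      refine (LinearMap.det_restrictScalars (R := ℝ)
        (f := (ContinuousLinearMap.toSpanSingleton ℂ (-(z ^ 2)⁻¹) : ℂ →ₗ[ℂ] ℂ))).trans ?_
      congr 1
      simp
    have h2 : (Complex.conjCLE : ℂ →L[ℝ] ℂ).det = -1 := Complex.det_conjAe
    have h3 : ∀ A B : ℂ →L[ℝ] ℂ, (A.comp B).det = A.det * B.det :=
      fun A B => LinearMap.det_comp _ _
    rw [h3, h1, h2, Complex.normSq_eq_norm_sq]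
    simp
    ring
  have hl : ∀ z : RHP, ‖cstarFun l h z‖ₑ ^ 2
      = (fun w : ℂ => ‖1 / w ^ (l + 2) * conj (F (σ w))‖ₑ ^ 2) z := fun z => by
    simp [cstarFun, e, reflect, hσ]
  simp only [hl]
  rw [lintegral_bergmanMeasure l (fun w : ℂ => ‖1 / w ^ (l + 2) * conj (F (σ w))‖ₑ ^ 2)]
  simp only [e]
  rw [lintegral_bergmanMeasure l (fun w : ℂ => ‖F w‖ₑ ^ 2)]
  conv_rhs => rw [← himg]
  rw [lintegral_image_eq_lintegral_abs_det_fderiv_mul volume measurableSet_rhp hder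
    ((Function.LeftInverse.injective hσσ).injOn)]
  refine setLIntegral_congr_fun measurableSet_rhp fun z hz => ?_
  simp only [hdet]
  have hz0 : 0 < ‖z‖ := norm_pos_iff.2 (ne_zero_of_mem_rhp hz)
  have hre : (σ z).re = z.re / ‖z‖ ^ 2 := by
    simp [hσ, Complex.inv_re, Complex.normSq_eq_norm_sq]
  have hz1 : 0 < z.re := hz
  have hpi := Real.pi_pos
  rw [hre, ← mul_assoc, ← ENNReal.ofReal_mul (by positivity), enorm_mul, mul_pow, ← mul_assoc,
    RCLike.enorm_conj, ← ofReal_norm (1 / z ^ (l + 2)), ← ENNReal.ofReal_pow (norm_nonneg _),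
    ← ENNReal.ofReal_mul (by positivity)]
  congr 2
  rw [norm_div, norm_one, norm_pow]
  simp only [div_pow, ← pow_mul, one_pow, inv_pow]
  field_simp
  ring

theorem cstarFun_mem {l : ℕ} {h : RHP → ℂ} (hh : h ∈ bergmanSubmodule l) :
    cstarFun l h ∈ bergmanSubmodule l := by
  refine ⟨cstarFun_analytic hh.1, ?_⟩
  rw [memLp_two_iff (cstarFun_analytic hh.1).continuous, lintegral_cstarFun hh.1,
    ← memLp_two_iff hh.1.continuous]
  exact hh.2

/-- The anti-linear operator `(C⋆ h)(z) = z^{-(ℓ+2)} conj (h (1 / conj z))` on the Bergman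
space. -/
def cstar (l : ℕ) : Bergman l →ₗ⋆[ℂ] Bergman l where
  toFun h := Bergman.mk (cstarFun l h) (cstarFun_mem h.2)
  map_add' h k := by ext z; simp [cstarFun, mul_add]
  map_smul' c h := by ext z; simp [cstarFun]; ring

theorem cstar_apply {l : ℕ} (h : Bergman l) (z : RHP) :
    cstar l h z = 1 / (z : ℂ) ^ (l + 2) * conj (h (reflect z)) := rfl

/-- For an anti-linear operator `C` defined on the whole space and a possibly unbounded linear
operator `T`, the operator `C T C`, with its natural domain `{x | C x ∈ dom T}`. -/
def conjugate {E : Type*} [AddCommGroup E] [Module ℂ E] (C : E →ₗ⋆[ℂ] E) (T : E →ₗ.[ℂ] E) :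
    E →ₗ.[ℂ] E where
  domain := T.domain.comap C
  toFun :=
    { toFun := fun x => C (T ⟨C x, x.2⟩)
      map_add' := fun x y => by
        rw [← map_add, ← LinearPMap.map_add]
        congr 2
        exact Subtype.ext (map_add C (x : E) y)
      map_smul' := fun c x => by
        have : T ⟨C ((c • x : T.domain.comap C) : E), (c • x).2⟩ = conj c • T ⟨C x, x.2⟩ := by
          rw [← LinearPMap.map_smul]
          congr 1
          exact Subtype.ext (by simp)
        rw [this, map_smulₛₗ]
        simp }

/-- The maximal weighted composition operator `h ↦ f · (h ∘ g)`, on the domain of all `h` in the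
Bergman space for which `f · (h ∘ g)` is again in the Bergman space. -/
def maxOp (l : ℕ) (f : RHP → ℂ) (g : RHP → RHP) : Bergman l →ₗ.[ℂ] Bergman l where
  domain :=
    { carrier := {h | (fun z => f z * h (g z)) ∈ bergmanSubmodule l}
      zero_mem' := by
        have : (fun z => f z * (0 : Bergman l) (g z)) = 0 := by ext z; simp
        change _ ∈ bergmanSubmodule l
        rw [this]
        exact zero_mem _
      add_mem' := fun {h k} hh hk => by
        have : (fun z => f z * (h + k) (g z))
            = (fun z => f z * h (g z)) + fun z => f z * k (g z) := by ext z; simp [mul_add]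
        change _ ∈ bergmanSubmodule l
        rw [this]
        exact add_mem hh hk
      smul_mem' := fun c h hh => by
        have : (fun z => f z * (c • h) (g z)) = c • fun z => f z * h (g z) := by
          ext z; simp; ring
        change _ ∈ bergmanSubmodule l
        rw [this]
        exact Submodule.smul_mem _ _ hh }
  toFun :=
    { toFun := fun h => Bergman.mk (fun z => f z * (h : Bergman l) (g z)) h.2
      map_add' := fun h k => by ext z; simp [mul_add]
      map_smul' := fun c h => by ext z; simp; ring }

/-- A densely defined operator `W` on the Bergman space is `C⋆`-selfadjoint if
`W = C⋆ W* C⋆`, equality of domains included. -/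
def IsCstarSelfadjoint {l : ℕ} (W : Bergman l →ₗ.[ℂ] Bergman l) : Prop :=
  Dense (W.domain : Set (Bergman l)) ∧ W = conjugate (cstar l) W.adjoint

/-- An operator is bounded if it is defined everywhere and `‖W h‖ ≤ L ‖h‖` for some `L > 0`. -/
def IsBoundedOp {l : ℕ} (W : Bergman l →ₗ.[ℂ] Bergman l) : Prop :=
  W.domain = ⊤ ∧ ∃ L : ℝ, 0 < L ∧ ∀ h : W.domain, ‖W h‖ ≤ L * ‖(h : Bergman l)‖

/-- First form: `g = α` and `f(w) = β / (1 + α w)^{ℓ+2}`, with `α` in the right half-plane and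
`β` complex. -/
def FormI (l : ℕ) (f : RHP → ℂ) (g : RHP → RHP) : Prop :=
  ∃ α β : ℂ, 0 < α.re ∧
    ∀ w : RHP, (g w : ℂ) = α ∧ f w = β / (1 + α * w) ^ (l + 2)

/-- Second form: `g(w) = λ w` and `f = θ`, with `λ > 0` real and `θ` complex. -/
def FormII (f : RHP → ℂ) (g : RHP → RHP) : Prop :=
  ∃ (lam : ℝ) (θ : ℂ), 0 < lam ∧ ∀ w : RHP, (g w : ℂ) = lam * w ∧ f w = θ

/-- The condition on the coefficients `δ`, `κ` in the third form. -/
def CondIII (δ κ : ℂ) : Prop :=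
  (δ.re = 0 ∧ (δ * κ).im = 0 ∧ (δ * κ).re < 1 ∧ 0 ≤ κ.re) ∨
    (-δ.re < 0 ∧ 0 ≤ κ.re - ((δ * κ - 1).re + ‖δ * κ - 1‖) / (2 * δ.re))

/-- Third form: `g(w) = δ + (1 - δ κ) / (w + κ)` and `f(w) = r / (w + κ)^{ℓ+2}`. -/
def FormIII (l : ℕ) (f : RHP → ℂ) (g : RHP → RHP) : Prop :=
  ∃ δ κ r : ℂ, CondIII δ κ ∧
    ∀ w : RHP, (g w : ℂ) = δ + (1 - δ * κ) / (w + κ) ∧ f w = r / (w + κ) ^ (l + 2)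

end HalfPlane

end

open HalfPlane

noncomputable section

open MeasureTheory Set Filter Topology
open scoped ComplexConjugate ENNReal InnerProductSpace

namespace HalfPlane

/-! Write m = ℓ+2 and let k_w(z) = (z + conj w)^(-m) be the unnormalised reproducing kernel, so that
⟪k_w, h⟫ is a positive constant times h(w) (`inner_kernel`). Any densely defined restriction W of
the maximal operator satisfies W* k_w = conj(f w) k_{g w}. Since (C⋆ k_w)(z) = (1 + wz)^(-m),
applying W = C⋆W*C⋆ to C⋆ k_w gives the symbol equation f(z)/(1 + w g(z))^m = f(w)/(1 + g(w) z)^m,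
that is, `SymbolSymmetry`.

Unless f vanishes identically, taking w = 1 expresses f through g, and eliminating f leaves an
equality of m-th powers in g alone. Continuity and connectedness remove the powers, and with w fixed
the result is linear in g(z). So g is a dilation, a constant or a Möbius map
(`SymbolSymmetry.forms`); the condition on δ and κ expresses that the Möbius map preserves the
half-plane (`condIII_of_mapsTo`).

Conversely each form satisfies the symbol equation and gives a bounded maximal operator: form I has
rank at most one, while forms II and III follow from a change of variables together with a
Schwarz–Pick estimate (`CondIII.le_re`). For a bounded maximal operator the symbol equation yields
C⋆-selfadjointness by testing on kernels (`isCstarSelfadjoint_maxOp`).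

Maximality is then automatic: a C⋆-selfadjoint W is contained in the C⋆-selfadjoint maximal
operator, and such an inclusion is an equality because adjoints reverse inclusions
(`eq_of_le_of_isCstarSelfadjoint`). -/

theorem measurable_weight_coe (l : ℕ) :
    Measurable fun z : RHP => ENNReal.ofReal ((z : ℂ).re ^ l / Real.pi) := by fun_prop

/-! ### Change of variables under injective holomorphic maps. -/

/-- The real derivative of a complex differentiable function has determinant `|G'|²`. -/
theorem abs_det_restrictScalars (a : ℂ) :
    |((ContinuousLinearMap.toSpanSingleton ℂ a).restrictScalars ℝ).det| = ‖a‖ ^ 2 := by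
  have h1 : ((ContinuousLinearMap.toSpanSingleton ℂ a).restrictScalars ℝ).det
      = Complex.normSq a := by
    rw [← Algebra.norm_complex_apply]
    refine (LinearMap.det_restrictScalars (R := ℝ)
      (f := (ContinuousLinearMap.toSpanSingleton ℂ a : ℂ →ₗ[ℂ] ℂ))).trans ?_
    congr 1
    simp
  rw [h1, Complex.normSq_eq_norm_sq, abs_of_nonneg (by positivity)]

theorem hasFDerivWithinAt_real {s : Set ℂ} {G : ℂ → ℂ} {a z : ℂ} (h : HasDerivAt G a z) :
    HasFDerivWithinAt G ((ContinuousLinearMap.toSpanSingleton ℂ a).restrictScalars ℝ) s z :=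
  (h.hasFDerivAt.restrictScalars ℝ).hasFDerivWithinAt

theorem lintegral_image_holomorphic {s : Set ℂ} (hs : MeasurableSet s) {G G' : ℂ → ℂ}
    (hG : ∀ z ∈ s, HasDerivAt G (G' z) z) (hi : InjOn G s) (u : ℂ → ℝ≥0∞) :
    ∫⁻ z in G '' s, u z = ∫⁻ z in s, ENNReal.ofReal (‖G' z‖ ^ 2) * u (G z) := by
  rw [lintegral_image_eq_lintegral_abs_det_fderiv_mul volume hs
    (fun z hz => hasFDerivWithinAt_real (hG z hz)) hi]
  simp only [abs_det_restrictScalars]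

theorem integral_image_holomorphic {s : Set ℂ} (hs : MeasurableSet s) {G G' : ℂ → ℂ}
    (hG : ∀ z ∈ s, HasDerivAt G (G' z) z) (hi : InjOn G s) (u : ℂ → ℂ) :
    ∫ z in G '' s, u z = ∫ z in s, (‖G' z‖ ^ 2) • u (G z) := by
  rw [integral_image_eq_integral_abs_det_fderiv_smul volume hs
    (fun z hz => hasFDerivWithinAt_real (hG z hz)) hi]
  simp only [abs_det_restrictScalars]

theorem integrableOn_image_holomorphic {s : Set ℂ} (hs : MeasurableSet s) {G G' : ℂ → ℂ}
    (hG : ∀ z ∈ s, HasDerivAt G (G' z) z) (hi : InjOn G s) (u : ℂ → ℂ) :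
    IntegrableOn u (G '' s) ↔ IntegrableOn (fun z => (‖G' z‖ ^ 2) • u (G z)) s := by
  rw [integrableOn_image_iff_integrableOn_abs_det_fderiv_smul volume hs
    (fun z hz => hasFDerivWithinAt_real (hG z hz)) hi]
  simp only [abs_det_restrictScalars]

/-! ### Mean values over the disc with a radial weight. -/

/-- The integral of an analytic function over a circle around a zero vanishes. -/
theorem integral_circle_eq_zero {F : ℂ → ℂ} {c : ℂ} {r : ℝ} (hr : 0 < r)
    (hF : DifferentiableOn ℂ F (Metric.closedBall c r)) (h0 : F c = 0) :
    ∫ θ in Ioo (-Real.pi) Real.pi, F (circleMap c r θ) = 0 := by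
  have h1 : DiffContOnCl ℂ F (Metric.ball c |r|) := by
    rw [abs_of_pos hr]
    refine DifferentiableOn.diffContOnCl ?_
    rwa [closure_ball c hr.ne']
  have h2 := h1.circleAverage
  rw [Real.circleAverage_eq_integral_add (-Real.pi),
    intervalIntegral.integral_comp_add_right (fun θ => F (circleMap c r θ)),
    inv_smul_eq_iff₀ (by positivity)] at h2
  have h3 : (0 : ℝ) + -Real.pi = -Real.pi := by ring
  have h4 : 2 * Real.pi + -Real.pi = Real.pi := by ring
  rwa [h3, h4, intervalIntegral.integral_of_le (by linarith [Real.pi_pos]),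
    integral_Ioc_eq_integral_Ioo, h0, smul_zero] at h2

/-- Radially weighted integrals over the disc of analytic functions vanishing at the centre
are zero. -/
theorem integral_ball_radial_eq_zero (w : ℝ → ℝ) {F : ℂ → ℂ}
    (hF : DifferentiableOn ℂ F (Metric.ball 0 1)) (h0 : F 0 = 0) :
    ∫ u in Metric.ball (0 : ℂ) 1, w ‖u‖ • F u = 0 := by
  set G : ℂ → ℂ := (Metric.ball (0 : ℂ) 1).indicator fun u => w ‖u‖ • F u with hG
  have hmap : ∀ p : ℝ × ℝ, Complex.polarCoord.symm p = circleMap 0 p.1 p.2 := fun p => by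
    rw [Complex.polarCoord_symm_apply, circleMap, Complex.exp_mul_I]
    push_cast
    ring
  rw [← integral_indicator measurableSet_ball, ← hG, ← Complex.integral_comp_polarCoord_symm,
    polarCoord_target]
  by_cases hint : IntegrableOn (fun p : ℝ × ℝ => p.1 • G (Complex.polarCoord.symm p))
    (Ioi (0 : ℝ) ×ˢ Ioo (-Real.pi) Real.pi)
  · rw [Measure.volume_eq_prod] at hint ⊢
    rw [setIntegral_prod _ hint]
    refine setIntegral_eq_zero_of_forall_eq_zero fun ρ hρ => ?_
    have hρ' : 0 < ρ := hρ
    simp only [hmap]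
    rw [integral_smul]
    by_cases h1 : ρ < 1
    · have h2 : ∀ θ, G (circleMap 0 ρ θ) = w ρ • F (circleMap 0 ρ θ) := fun θ => by
        have : circleMap 0 ρ θ ∈ Metric.ball (0 : ℂ) 1 := by
          simpa [abs_of_pos hρ'] using h1
        rw [hG, indicator_of_mem this, norm_circleMap_zero, abs_of_pos hρ']
      simp only [h2]
      rw [integral_smul, integral_circle_eq_zero hρ'
        (hF.mono (Metric.closedBall_subset_ball h1)) h0, smul_zero, smul_zero]
    · have h2 : ∀ θ, G (circleMap 0 ρ θ) = 0 := fun θ => by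
        have : circleMap 0 ρ θ ∉ Metric.ball (0 : ℂ) 1 := by
          simpa [abs_of_pos hρ'] using h1
        rw [hG, indicator_of_notMem this]
      simp only [h2, integral_zero, smul_zero]
  -- The integral of a non-integrable function is 0 by convention, so no integrability hypothesis is
  -- needed.
  · exact integral_undef hint

/-- The total mass of the weight `(1 - |u|²)^ℓ` on the unit disc. -/
def discMass (l : ℕ) : ℝ := ∫ u in Metric.ball (0 : ℂ) 1, (1 - ‖u‖ ^ 2) ^ l

theorem integrableOn_discWeight (l : ℕ) :
    IntegrableOn (fun u : ℂ => (1 - ‖u‖ ^ 2) ^ l) (Metric.ball 0 1) := by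
  have : Continuous (fun u : ℂ => (1 - ‖u‖ ^ 2) ^ l) := by fun_prop
  exact (this.continuousOn.integrableOn_compact (isCompact_closedBall (0 : ℂ) 1)).mono_set
    Metric.ball_subset_closedBall

theorem one_sub_norm_sq_pos {u : ℂ} (hu : u ∈ Metric.ball (0 : ℂ) 1) : 0 < 1 - ‖u‖ ^ 2 := by
  have h1 : ‖u‖ < 1 := by simpa using hu
  nlinarith [norm_nonneg u]

theorem discMass_pos (l : ℕ) : 0 < discMass l := by
  rw [discMass, setIntegral_pos_iff_support_of_nonneg_ae]
  · refine (Metric.measure_ball_pos volume (0 : ℂ) one_pos).trans_le (measure_mono fun u hu => ?_)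
    exact ⟨(pow_pos (one_sub_norm_sq_pos hu) l).ne', hu⟩
  · refine (ae_restrict_iff' measurableSet_ball).2 (ae_of_all _ fun u hu => ?_)
    exact (pow_pos (one_sub_norm_sq_pos hu) l).le
  · exact integrableOn_discWeight l

/-- Mean value property of analytic functions for the weight `(1 - |u|²)^ℓ` on the disc. -/
theorem integral_disc_mean {l : ℕ} {F : ℂ → ℂ} (hF : DifferentiableOn ℂ F (Metric.ball 0 1))
    (hi : IntegrableOn (fun u => ((1 - ‖u‖ ^ 2) ^ l) • F u) (Metric.ball 0 1)) :
    ∫ u in Metric.ball (0 : ℂ) 1, ((1 - ‖u‖ ^ 2) ^ l) • F u = discMass l * F 0 := by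
  have h1 := integral_ball_radial_eq_zero (fun r => (1 - r ^ 2) ^ l)
    (F := fun u => F u - F 0) (hF.sub_const _) (sub_self _)
  simp only [smul_sub] at h1
  rw [integral_sub hi ((integrableOn_discWeight l).smul_const _), sub_eq_zero] at h1
  rw [h1, integral_smul_const, discMass, Complex.real_smul]

/-! ### The Cayley transform and the reproducing kernel. -/

theorem integral_bergmanMeasure (l : ℕ) (G : ℂ → ℂ) :
    ∫ z : RHP, G z ∂(bergmanMeasure l) = ∫ z in rhp, (z.re ^ l / Real.pi) • G z := by
  rw [bergmanMeasure, integral_withDensity_eq_integral_toReal_smul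
    (measurable_weight_coe l) (ae_of_all _ fun _ => ENNReal.ofReal_lt_top)]
  have h : ∀ z : RHP, (ENNReal.ofReal ((z : ℂ).re ^ l / Real.pi)).toReal
      = (z : ℂ).re ^ l / Real.pi := fun z => by
    have := z.2
    exact ENNReal.toReal_ofReal (by positivity)
  simp only [h]
  exact integral_subtype_comap measurableSet_rhp (fun z : ℂ => (z.re ^ l / Real.pi) • G z)

theorem integrable_bergmanMeasure_iff (l : ℕ) (G : ℂ → ℂ) :
    Integrable (fun z : RHP => G z) (bergmanMeasure l)
      ↔ IntegrableOn (fun z => (z.re ^ l / Real.pi) • G z) rhp := by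
  rw [bergmanMeasure, integrable_withDensity_iff_integrable_smul'
    (measurable_weight_coe l) (ae_of_all _ fun _ => ENNReal.ofReal_lt_top)]
  have h : ∀ z : RHP, (ENNReal.ofReal ((z : ℂ).re ^ l / Real.pi)).toReal
      = (z : ℂ).re ^ l / Real.pi := fun z => by
    have := z.2
    exact ENNReal.toReal_ofReal (by positivity)
  simp only [h]
  exact (integrableOn_iff_comap_subtypeVal (f := fun z : ℂ => (z.re ^ l / Real.pi) • G z)
    measurableSet_rhp).symm

/-- The Möbius map `u ↦ (w + conj w u) / (1 - u)` of the unit disc onto the half-plane. -/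
def cayley (w u : ℂ) : ℂ := (w + conj w * u) / (1 - u)

theorem one_sub_ne_zero_of_mem_ball {u : ℂ} (hu : u ∈ Metric.ball (0 : ℂ) 1) : 1 - u ≠ 0 := by
  intro h
  rw [← sub_eq_zero.1 h] at hu
  simp at hu

theorem add_conj_eq (w : ℂ) : w + conj w = 2 * (w.re : ℂ) := by
  rw [Complex.add_conj]
  push_cast
  ring

theorem cayley_add_conj (w : ℂ) {u : ℂ} (hu : u ∈ Metric.ball (0 : ℂ) 1) :
    cayley w u + conj w = 2 * w.re / (1 - u) := by
  have := one_sub_ne_zero_of_mem_ball hu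
  rw [cayley, ← add_conj_eq]
  field_simp
  ring

theorem hasDerivAt_cayley (w : ℂ) {u : ℂ} (hu : u ∈ Metric.ball (0 : ℂ) 1) :
    HasDerivAt (cayley w) (2 * w.re / (1 - u) ^ 2) u := by
  have h0 := one_sub_ne_zero_of_mem_ball hu
  have h1 : HasDerivAt (fun u => w + conj w * u) (conj w) u := by
    simpa using ((hasDerivAt_id u).const_mul (conj w)).const_add w
  have h2 : HasDerivAt (fun u : ℂ => 1 - u) (-1) u := by
    simpa using (hasDerivAt_id u).const_sub 1
  convert! h1.div h2 h0 using 1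
  rw [← add_conj_eq]
  congr 1
  ring

theorem cayley_re (w u : ℂ) :
    (cayley w u).re = w.re * (1 - ‖u‖ ^ 2) / ‖1 - u‖ ^ 2 := by
  rw [cayley, Complex.div_re, ← Complex.normSq_eq_norm_sq, ← Complex.normSq_eq_norm_sq, ← add_div]
  congr 1
  simp [Complex.normSq_apply]
  ring

theorem injOn_cayley {w : ℂ} (hw : 0 < w.re) : InjOn (cayley w) (Metric.ball 0 1) := by
  intro u hu v hv h
  have h1 := cayley_add_conj w hu
  rw [h, cayley_add_conj w hv] at h1
  have h2 := one_sub_ne_zero_of_mem_ball hu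
  have h3 := one_sub_ne_zero_of_mem_ball hv
  have h4 : (w.re : ℂ) ≠ 0 := by exact_mod_cast hw.ne'
  field_simp at h1
  linear_combination -h1

theorem cayley_mem {w : ℂ} (hw : 0 < w.re) {u : ℂ} (hu : u ∈ Metric.ball (0 : ℂ) 1) :
    cayley w u ∈ rhp := by
  have h1 := norm_pos_iff.2 (one_sub_ne_zero_of_mem_ball hu)
  have h2 := one_sub_norm_sq_pos hu
  change 0 < (cayley w u).re
  rw [cayley_re]
  positivity

theorem image_cayley {w : ℂ} (hw : 0 < w.re) : cayley w '' Metric.ball 0 1 = rhp := by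
  refine Subset.antisymm (image_subset_iff.2 fun u hu => cayley_mem hw hu) fun z hz => ?_
  have hz' : 0 < z.re := hz
  have h0 : z + conj w ≠ 0 := fun h => by
    have := congrArg Complex.re h
    simp at this
    linarith
  have h4 : w + conj w ≠ 0 := by
    rw [add_conj_eq]
    exact mul_ne_zero two_ne_zero (by exact_mod_cast hw.ne')
  refine ⟨(z - w) / (z + conj w), ?_, ?_⟩
  · rw [mem_ball_zero_iff, norm_div, div_lt_one (norm_pos_iff.2 h0),
      ← sq_lt_sq₀ (norm_nonneg _) (norm_nonneg _), ← Complex.normSq_eq_norm_sq,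
      ← Complex.normSq_eq_norm_sq]
    simp [Complex.normSq_apply]
    nlinarith
  · rw [cayley]
    have h5 : 1 - (z - w) / (z + conj w) = (w + conj w) / (z + conj w) := by
      field_simp
      ring
    rw [h5]
    field_simp
    ring

theorem add_conj_ne_zero {z w : ℂ} (hz : 0 < z.re) (hw : 0 < w.re) : z + conj w ≠ 0 := fun h => by
  have := congrArg Complex.re h
  simp at this
  linarith

/-- The unnormalised reproducing kernel `z ↦ (z + conj w)^{-(ℓ+2)}`. -/
def kernelFun (l : ℕ) (w z : ℂ) : ℂ := 1 / (z + conj w) ^ (l + 2)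

theorem analyticOnNhd_kernelFun (l : ℕ) {w : ℂ} (hw : 0 < w.re) :
    AnalyticOnNhd ℂ (kernelFun l w) rhp := by
  refine DifferentiableOn.analyticOnNhd (fun z hz => ?_) isOpen_rhp
  refine DifferentiableAt.differentiableWithinAt ?_
  exact (differentiableAt_const _).div (by fun_prop) (pow_ne_zero _ (add_conj_ne_zero hz hw))

theorem kernelFun_cayley (l : ℕ) (w : ℂ) {u : ℂ} (hu : u ∈ Metric.ball (0 : ℂ) 1) :
    kernelFun l w (cayley w u) = (1 - u) ^ (l + 2) / (2 * w.re) ^ (l + 2) := by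
  rw [kernelFun, cayley_add_conj w hu, div_pow, one_div_div]

/-- Pulled back to the disc by `cayley w`, the weight and the Jacobian contribute |1-u|^(-2(ℓ+2)),
which the squared kernel cancels exactly. What remains is a constant times (1-|u|²)^ℓ ≤ 1 on a set
of finite measure. -/
theorem kernelFun_mem (l : ℕ) (w : RHP) :
    (fun z : RHP => kernelFun l w z) ∈ bergmanSubmodule l := by
  have hw : 0 < (w : ℂ).re := w.2
  have hpi := Real.pi_pos
  have ha : IsAnalytic (fun z : RHP => kernelFun l w z) :=
    ⟨kernelFun l w, analyticOnNhd_kernelFun l hw, fun _ => rfl⟩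
  refine ⟨ha, (memLp_two_iff ha.continuous l).2 ?_⟩
  rw [lintegral_bergmanMeasure l (fun z => ‖kernelFun l w z‖ₑ ^ 2), ← image_cayley hw,
    lintegral_image_holomorphic measurableSet_ball (fun u hu => hasDerivAt_cayley w hu)
      (injOn_cayley hw)]
  set a := (w : ℂ).re with hadef
  calc _ ≤ ∫⁻ u in Metric.ball (0 : ℂ) 1,
        ENNReal.ofReal (4 * a ^ 2 * a ^ l / Real.pi / (2 * a) ^ (2 * (l + 2))) := by
        refine setLIntegral_mono' measurableSet_ball fun u hu => ?_
        have h1 : 0 < ‖1 - u‖ := norm_pos_iff.2 (one_sub_ne_zero_of_mem_ball hu)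
        have h2 := one_sub_norm_sq_pos hu
        have h3 : (1 - ‖u‖ ^ 2) ^ l ≤ 1 := pow_le_one₀ h2.le (by nlinarith [norm_nonneg u])
        rw [kernelFun_cayley l w hu, cayley_re, ← hadef, ← ofReal_norm, ← ENNReal.ofReal_pow (norm_nonneg _),
          ← ENNReal.ofReal_mul (by positivity), ← ENNReal.ofReal_mul (by positivity)]
        refine ENNReal.ofReal_le_ofReal ?_
        have h4 : ‖(2 * (a : ℂ))‖ = 2 * a := by
          rw [norm_mul, Complex.norm_real, Complex.norm_ofNat, Real.norm_of_nonneg hw.le]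
        rw [norm_div, norm_div, norm_pow, norm_pow, norm_pow, h4, div_pow (a * _), mul_pow a]
        calc _ = 4 * a ^ 2 * a ^ l / Real.pi / (2 * a) ^ (2 * (l + 2)) * (1 - ‖u‖ ^ 2) ^ l := by
              field_simp
              ring
          _ ≤ 4 * a ^ 2 * a ^ l / Real.pi / (2 * a) ^ (2 * (l + 2)) * 1 := by gcongr
          _ = _ := mul_one _
    _ < ∞ := by
        rw [setLIntegral_const]
        exact ENNReal.mul_lt_top ENNReal.ofReal_lt_top measure_ball_lt_top

/-- The unnormalised reproducing kernel as an element of the Bergman space. -/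
def kernel (l : ℕ) (w : RHP) : Bergman l := Bergman.mk _ (kernelFun_mem l w)

theorem kernel_apply (l : ℕ) (w z : RHP) :
    kernel l w z = 1 / ((z : ℂ) + conj (w : ℂ)) ^ (l + 2) := rfl

/-- The normalising constant of the reproducing kernel. -/
def kernelConst (l : ℕ) : ℝ := discMass l / (2 ^ l * Real.pi)

theorem kernelConst_pos (l : ℕ) : 0 < kernelConst l := by
  have := discMass_pos l
  have := Real.pi_pos
  unfold kernelConst
  positivity

theorem kernelConst_ne_zero (l : ℕ) : (kernelConst l : ℂ) ≠ 0 := by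
  exact_mod_cast (kernelConst_pos l).ne'

/-- The reproducing property of the kernel. -/
theorem inner_kernel {l : ℕ} (w : RHP) (h : Bergman l) :
    ⟪kernel l w, h⟫_ℂ = kernelConst l * h w := by
  obtain ⟨H, hH, e⟩ := h.analytic
  have hw : 0 < (w : ℂ).re := w.2
  have hpi := Real.pi_pos
  set a := (w : ℂ).re with hadef
  have hint : Integrable (fun z : RHP => conj (kernelFun l w z) * H z) (bergmanMeasure l) := by
    simp only [← e]
    exact (MemLp.integrable_mul (kernel l w).memLp.star h.memLp)
  -- The conjugated kernel cancels only the antiholomorphic half of |1-u|^(-2(ℓ+2)). The weight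
  -- (1-|u|²)^ℓ is left against an analytic function of u whose value at u = 0 is H(w), so the disc
  -- mean value property applies.
  have hpt : ∀ u ∈ Metric.ball (0 : ℂ) 1,
      (‖2 * a / (1 - u) ^ 2‖ ^ 2) • ((cayley w u).re ^ l / Real.pi) •
          (conj (kernelFun l w (cayley w u)) * H (cayley w u))
        = (1 / (2 ^ l * Real.pi)) • ((1 - ‖u‖ ^ 2) ^ l) •
          (H (cayley w u) / (1 - u) ^ (l + 2)) := fun u hu => by
    have h0 := one_sub_ne_zero_of_mem_ball hu
    have h0' : conj (1 - u) ≠ 0 := (map_ne_zero _).2 h0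
    have ha : (a : ℂ) ≠ 0 := by exact_mod_cast hw.ne'
    have hpi' : (Real.pi : ℂ) ≠ 0 := by exact_mod_cast hpi.ne'
    have h4 : ‖(2 * (a : ℂ))‖ = 2 * a := by
      rw [norm_mul, Complex.norm_real, Complex.norm_ofNat, Real.norm_of_nonneg hw.le]
    have h5 : ((‖1 - u‖ : ℝ) : ℂ) ^ 2 = (1 - u) * conj (1 - u) := by
      rw [Complex.mul_conj, Complex.normSq_eq_norm_sq]
      push_cast
      rfl
    have h6 : ((‖(1 - u) ^ 2‖ : ℝ) : ℂ) = (1 - u) * conj (1 - u) := by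
      rw [norm_pow, ← h5]
      push_cast
      rfl
    rw [kernelFun_cayley l w hu, cayley_re, ← hadef, norm_div, h4, div_pow (a * _), mul_pow a]
    simp only [Complex.real_smul, map_div₀, map_pow, map_mul, Complex.conj_ofReal, map_ofNat]
    push_cast
    rw [h5, h6]
    generalize conj (1 - u) = v at *
    generalize 1 - u = s at *
    generalize H (cayley w u) = t
    field_simp
    ring
  rw [Bergman.inner_def]
  change ∫ z : RHP, conj (kernelFun l w z) * h z ∂(bergmanMeasure l) = _
  simp only [e]
  rw [integrable_bergmanMeasure_iff l (fun z => conj (kernelFun l w z) * H z), ← image_cayley hw,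
    integrableOn_image_holomorphic measurableSet_ball (fun u hu => hasDerivAt_cayley w hu)
      (injOn_cayley hw), integrableOn_congr_fun hpt measurableSet_ball, IntegrableOn,
      integrable_fun_smul_iff (by positivity)] at hint
  rw [integral_bergmanMeasure l (fun z => conj (kernelFun l w z) * H z), ← image_cayley hw,
    integral_image_holomorphic measurableSet_ball (fun u hu => hasDerivAt_cayley w hu)
      (injOn_cayley hw), setIntegral_congr_fun measurableSet_ball hpt, integral_smul,
    integral_disc_mean _ hint, kernelConst]
  · have : cayley w 0 = w := by simp [cayley]
    rw [this, Complex.real_smul]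
    push_cast
    simp
    ring
  · intro u hu
    refine DifferentiableAt.differentiableWithinAt (DifferentiableAt.div ?_ (by fun_prop)
      (pow_ne_zero _ (one_sub_ne_zero_of_mem_ball hu)))
    exact (hH _ (cayley_mem hw hu)).differentiableAt.comp u
      (hasDerivAt_cayley w hu).differentiableAt

/-! ### The symbol equation and Möbius self-maps of the half-plane. -/

theorem one_add_mul_ne_zero {z w : ℂ} (hz : 0 < z.re) (hw : 0 < w.re) : 1 + w * z ≠ 0 := fun h => by
  have h1 := congrArg Complex.re h
  have h2 := congrArg Complex.im h
  simp at h1 h2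
  -- This is the real part of conj w · (1 + wz) = conj w + |w|² z.
  have h3 : w.re + (w.re ^ 2 + w.im ^ 2) * z.re = 0 := by
    linear_combination w.re * h1 + w.im * h2
  have : 0 ≤ (w.re ^ 2 + w.im ^ 2) * z.re := by positivity
  linarith

/-- The functional equation satisfied by the symbols of a `C⋆`-selfadjoint weighted composition
operator. -/
def SymbolSymmetry (l : ℕ) (f : RHP → ℂ) (g : RHP → RHP) : Prop :=
  ∀ z w : RHP, f z / (1 + (w : ℂ) * g z) ^ (l + 2) = f w / (1 + (g w : ℂ) * z) ^ (l + 2)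

/-- Turns positivity of the real part of the Möbius map into a real quadratic inequality in u = z +
κ. When Re δ > 0 it describes the exterior of the disc with centre -μ/(2 Re δ) and radius |μ|/(2 Re
δ). -/
theorem re_mobius_mul_sq {δ μ u : ℂ} (hu : u ≠ 0) :
    (δ + μ / u).re * ‖u‖ ^ 2
      = δ.re * (u.re ^ 2 + u.im ^ 2) + (μ.re * u.re + μ.im * u.im) := by
  have h := Complex.normSq_pos.2 hu
  rw [← Complex.normSq_eq_norm_sq, Complex.add_re, Complex.div_re, add_mul]
  field_simp
  rw [Complex.normSq_apply]
  ring

theorem sq_norm_eq (μ : ℂ) : ‖μ‖ ^ 2 = μ.re ^ 2 + μ.im ^ 2 := by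
  rw [← Complex.normSq_eq_norm_sq, Complex.normSq_apply]
  ring

theorem CondIII.re_nonneg {δ κ : ℂ} (h : CondIII δ κ) : 0 ≤ κ.re := by
  rcases h with h | ⟨h1, h2⟩
  · exact h.2.2.2
  · have h3 : 0 ≤ ((δ * κ - 1).re + ‖δ * κ - 1‖) / (2 * δ.re) := by
      have := neg_le_of_abs_le (Complex.abs_re_le_norm (δ * κ - 1))
      exact div_nonneg (by linarith) (by linarith)
    linarith

theorem add_ne_zero_of_re {z κ : ℂ} (hz : 0 < z.re) (hκ : 0 ≤ κ.re) : z + κ ≠ 0 := fun h => by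
  have := congrArg Complex.re h
  simp at this
  linarith

/-- Quantitative form of the fact that the third form maps the half-plane to itself. -/
theorem CondIII.le_re {δ κ z : ℂ} (h : CondIII δ κ) (hz : 0 < z.re) :
    ‖1 - δ * κ‖ * z.re ≤ (δ + (1 - δ * κ) / (z + κ)).re * ‖z + κ‖ ^ 2 := by
  have hκ := h.re_nonneg
  rw [re_mobius_mul_sq (add_ne_zero_of_re hz hκ)]
  rcases h with ⟨h1, h2, h3, -⟩ | ⟨h1, h2⟩
  · have h4 : 1 - δ * κ = ((1 - (δ * κ).re : ℝ) : ℂ) := by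
      apply Complex.ext <;> simp [h2, -Complex.mul_re, -Complex.mul_im]
    have h5 : ‖1 - δ * κ‖ = 1 - (δ * κ).re := by
      rw [h4, Complex.norm_real, Real.norm_of_nonneg (by linarith)]
    rw [h5, h1, Complex.sub_re, Complex.sub_im, h2, Complex.add_re]
    simp only [Complex.one_re, Complex.one_im]
    nlinarith
  · set μ := 1 - δ * κ with hμ
    have h4 : δ * κ - 1 = -μ := by rw [hμ]; ring
    rw [h4, norm_neg, Complex.neg_re, sub_nonneg, div_le_iff₀ (by linarith)] at h2
    have h5 := sq_norm_eq μ
    have hd : 0 < δ.re := by linarith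
    set d := δ.re
    set x := (z + κ).re with hx
    set y := (z + κ).im
    have hxk : x = z.re + κ.re := Complex.add_re _ _
    have h6 := norm_nonneg μ
    -- As |1-δκ|/|z+κ|² is the modulus of the derivative of the map, the claim is the Schwarz–Pick
    -- inequality. Completing squares, 4d times the difference of its two sides is the sum of the
    -- three nonnegative terms `h7`, `h8` and `h9`.
    have h7 : 0 ≤ (2 * d * x + μ.re - ‖μ‖ - 2 * d * z.re) * (2 * d * x + μ.re + ‖μ‖) := by
      apply mul_nonneg
      · rw [hxk]; nlinarith
      · rw [hxk]; nlinarith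
    have h8 : 0 ≤ 2 * d * z.re * (2 * d * x + μ.re - ‖μ‖) := by
      apply mul_nonneg (by positivity)
      rw [hxk]; nlinarith
    have h9 := sq_nonneg (2 * d * y + μ.im)
    have h10 : 0 ≤ 4 * d * (d * (x ^ 2 + y ^ 2) + (μ.re * x + μ.im * y) - ‖μ‖ * z.re) := by
      linarith
    have := nonneg_of_mul_nonneg_right h10 (by positivity)
    linarith

/-- The translated half-plane Re u > Re κ must avoid the disc where the quadratic form of
`re_mobius_mul_sq` is negative. If Re δ > 0, this bounds Re κ below by the abscissa of the rightmost
point of the disc. If Re δ = 0, the form is linear and must not depend on Im u. -/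
theorem condIII_of_mapsTo {δ κ : ℂ} (hκ : 0 ≤ κ.re)
    (h : ∀ z : ℂ, 0 < z.re → 0 < (δ + (1 - δ * κ) / (z + κ)).re) : CondIII δ κ := by
  have key : ∀ x y : ℝ, κ.re < x →
      0 < δ.re * (x ^ 2 + y ^ 2) + ((1 - δ * κ).re * x + (1 - δ * κ).im * y) := fun x y hx => by
    have hz : 0 < ((⟨x, y⟩ : ℂ) - κ).re := by simpa using hx
    have h1 := h _ hz
    have h2 : (⟨x, y⟩ : ℂ) ≠ 0 := fun h0 => by
      have := congrArg Complex.re h0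
      simp at this
      linarith
    rw [sub_add_cancel] at h1
    have h3 := mul_pos h1 (pow_pos (norm_pos_iff.2 h2) 2)
    rwa [re_mobius_mul_sq h2] at h3
  unfold CondIII
  have h4 : δ * κ - 1 = -(1 - δ * κ) := by ring
  have h5 : (δ * κ).re = 1 - (1 - δ * κ).re := by simp [-Complex.mul_re]
  have h6 : (δ * κ).im = - (1 - δ * κ).im := by simp [-Complex.mul_im]
  rw [h4, h5, h6, norm_neg, Complex.neg_re]
  set μ := 1 - δ * κ
  have hn := sq_norm_eq μ
  have hd0 : 0 ≤ δ.re := by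
    by_contra! hd
    -- On the real axis the form is x (Re δ · x + Re μ), which is not positive for such large x when
    -- Re δ < 0.
    set x := max (κ.re + 1) (μ.re / (-δ.re)) with hx
    have hx1 : κ.re + 1 ≤ x := le_max_left _ _
    have hx2 : μ.re / (-δ.re) ≤ x := le_max_right _ _
    rw [div_le_iff₀ (by linarith)] at hx2
    have := key x 0 (by linarith)
    nlinarith
  rcases hd0.eq_or_lt with hd | hd
  · left
    rw [← hd] at key
    have him : μ.im = 0 := by
      by_contra him
      -- This ordinate makes the linear form vanish.
      have := key (κ.re + 1) (-(μ.re * (κ.re + 1)) / μ.im) (by linarith)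
      rw [mul_div_cancel₀ _ him] at this
      linarith
    refine ⟨hd.symm, by rw [him, neg_zero], ?_, hκ⟩
    have := key (κ.re + 1) 0 (by linarith)
    nlinarith
  · right
    refine ⟨by linarith, ?_⟩
    rw [sub_nonneg]
    by_contra! hlt
    -- The test point (X, Y) is the rightmost point of the excluded disc; the form is zero there.
    have h7 := key _ (-μ.im / (2 * δ.re)) hlt
    set X := (-μ.re + ‖μ‖) / (2 * δ.re) with hX
    set Y := -μ.im / (2 * δ.re) with hY
    have hX' : 2 * δ.re * X = -μ.re + ‖μ‖ := by rw [hX]; field_simp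
    have hY' : 2 * δ.re * Y = -μ.im := by rw [hY]; field_simp
    have h8 : 4 * δ.re * (δ.re * (X ^ 2 + Y ^ 2) + (μ.re * X + μ.im * Y)) = 0 := by
      linear_combination (2 * δ.re * X + ‖μ‖ + μ.re) * hX' + (2 * δ.re * Y + μ.im) * hY' + hn
    have := mul_pos (by positivity : 0 < 4 * δ.re) h7
    linarith

/-! ### Solving the symbol equation. -/

/-- The point `1` of the half-plane. -/
def rhpOne : RHP := ⟨1, by simp⟩

instance : PreconnectedSpace RHP :=
  isPreconnected_iff_preconnectedSpace.1 (convex_halfSpace_re_gt 0).isPreconnected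

/-- A continuous function on a preconnected space whose `m`-th power is constantly `1` and which
takes the value `1` is constantly `1`. -/
theorem eq_one_of_pow_eq_one {X : Type*} [TopologicalSpace X] [PreconnectedSpace X] {φ : X → ℂ}
    (hφ : Continuous φ) {m : ℕ} (hm : 0 < m) (hp : ∀ x, φ x ^ m = 1) {x₀ : X} (h0 : φ x₀ = 1)
    (x : X) : φ x = 1 := by
  have hfin : {y : ℂ | y ^ m = 1}.Finite := by
    refine (Polynomial.nthRootsFinset m (1 : ℂ)).finite_toSet.subset fun y hy => ?_
    exact (Polynomial.mem_nthRootsFinset hm 1).2 hy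
  rw [← h0]
  exact isPreconnected_univ.constant_of_mapsTo hfin.isDiscrete hφ.continuousOn
    (fun x _ => hp x) (mem_univ x) (mem_univ x₀)

theorem SymbolSymmetry.mul_eq {l : ℕ} {f : RHP → ℂ} {g : RHP → RHP} (h : SymbolSymmetry l f g)
    (z w : RHP) :
    f z * (1 + (g w : ℂ) * z) ^ (l + 2) = f w * (1 + (w : ℂ) * g z) ^ (l + 2) := by
  have := h z w
  rwa [div_eq_div_iff (pow_ne_zero _ (one_add_mul_ne_zero (g z).2 w.2))
    (pow_ne_zero _ (one_add_mul_ne_zero z.2 (g w).2))] at this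

/-- A single zero of f forces f to vanish identically, so outside that case f(1) can be cancelled.
-/
theorem SymbolSymmetry.ne_zero {l : ℕ} {f : RHP → ℂ} {g : RHP → RHP} (h : SymbolSymmetry l f g)
    {z : RHP} (hz : f z ≠ 0) (w : RHP) : f w ≠ 0 := fun h0 => by
  have := h.mul_eq z w
  rw [h0, zero_mul] at this
  exact mul_ne_zero hz (pow_ne_zero _ (one_add_mul_ne_zero z.2 (g w).2)) this

theorem SymbolSymmetry.mul_eq_one {l : ℕ} {f : RHP → ℂ} {g : RHP → RHP}
    (h : SymbolSymmetry l f g) (z : RHP) :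
    f z * (1 + (g rhpOne : ℂ) * z) ^ (l + 2) = f rhpOne * (1 + (g z : ℂ)) ^ (l + 2) := by
  have := h.mul_eq z rhpOne
  simpa [rhpOne] using this

/-- Eliminating f by `mul_eq_one` gives this identity between (ℓ+2)-th powers. The quotient of the
two sides is thus a continuous function of z whose values are roots of unity; it equals 1 at z = 1,
hence everywhere. -/
theorem SymbolSymmetry.functional_equation {l : ℕ} {f : RHP → ℂ} {g : RHP → RHP}
    (h : SymbolSymmetry l f g) (hg : Continuous fun z => (g z : ℂ)) (h1 : f rhpOne ≠ 0)
    (z w : RHP) :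
    (1 + (g w : ℂ) * z) * (1 + g z) * (1 + (g rhpOne : ℂ) * w)
      = (1 + (w : ℂ) * g z) * (1 + g w) * (1 + (g rhpOne : ℂ) * z) := by
  have hre : 0 < (1 : ℂ).re := by simp
  have hne1 : ∀ z : RHP, 1 + (g z : ℂ) ≠ 0 := fun z => by
    simpa using one_add_mul_ne_zero hre (g z).2
  have hden : ∀ z : RHP, (1 + (w : ℂ) * g z) * (1 + g w) * (1 + (g rhpOne : ℂ) * z) ≠ 0 :=
    fun z => mul_ne_zero (mul_ne_zero (one_add_mul_ne_zero (g z).2 w.2) (hne1 w))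
      (one_add_mul_ne_zero z.2 (g rhpOne).2)
  have := eq_one_of_pow_eq_one (X := RHP) (m := l + 2)
    (φ := fun z => (1 + (g w : ℂ) * z) * (1 + g z) * (1 + (g rhpOne : ℂ) * w)
      / ((1 + (w : ℂ) * g z) * (1 + g w) * (1 + (g rhpOne : ℂ) * z)))
    (Continuous.div (by fun_prop) (by fun_prop) hden) (by omega)
    (fun z => by
      rw [div_pow, div_eq_one_iff_eq (pow_ne_zero _ (hden z))]
      simp only [mul_pow]
      apply mul_left_cancel₀ h1
      linear_combination
        (-(1 + (g w : ℂ) * z) ^ (l + 2) * (1 + (g rhpOne : ℂ) * w) ^ (l + 2)) * h.mul_eq_one z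
        + (1 + (w : ℂ) * g z) ^ (l + 2) * (1 + (g rhpOne : ℂ) * z) ^ (l + 2) * h.mul_eq_one w
        + (1 + (g rhpOne : ℂ) * z) ^ (l + 2) * (1 + (g rhpOne : ℂ) * w) ^ (l + 2) * h.mul_eq z w)
    (x₀ := rhpOne) (by
      rw [div_eq_one_iff_eq (hden _)]
      simp only [rhpOne]
      ring) z
  exact (div_eq_one_iff_eq (hden z)).1 this

/-- Solutions of the functional equation of the symbols. -/
theorem SymbolSymmetry.forms {l : ℕ} {f : RHP → ℂ} {g : RHP → RHP} (h : SymbolSymmetry l f g)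
    (hg : Continuous fun z => (g z : ℂ)) :
    (∀ z, f z = 0) ∨ FormI l f g ∨ FormII f g ∨ FormIII l f g := by
  by_cases h0 : ∀ z, f z = 0
  · exact Or.inl h0
  right
  push Not at h0
  obtain ⟨z₀, hz₀⟩ := h0
  have h1 : f rhpOne ≠ 0 := h.ne_zero hz₀ _
  have hfe := h.functional_equation hg h1
  have hf := h.mul_eq_one
  set a : ℂ := (g rhpOne : ℂ) with ha
  have hare : 0 < a.re := (g rhpOne).2
  by_cases hB : ∀ w : RHP, (g w : ℂ) = a * w
  · right; left
    have him : a.im = 0 := by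
      by_contra him
      -- At this point of the half-plane Re(a w) = 0, so a non-real slope is impossible.
      have h2 := (g ⟨⟨1, a.re / a.im⟩, by simp⟩).2
      rw [hB] at h2
      simp [mul_div_cancel₀ _ him] at h2
    have har : a = (a.re : ℂ) := Complex.ext rfl (by simp [him])
    refine ⟨a.re, f rhpOne, hare, fun w => ⟨by rw [← har, hB], ?_⟩⟩
    have h2 := hf w
    rw [hB w] at h2
    exact mul_right_cancel₀ (pow_ne_zero _ (one_add_mul_ne_zero w.2 hare)) h2
  push Not at hB
  obtain ⟨w₀, hw₀⟩ := hB
  -- With w = w₀ fixed, the functional equation is linear in g(z). The coefficient of z g(z) and the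
  -- constant term are both g(w₀) - a w₀, which is nonzero; dividing by it gives κ and δ.
  obtain ⟨κ, δ, hgz⟩ : ∃ κ δ : ℂ, ∀ z : RHP, (g z : ℂ) * (z + κ) = 1 + δ * z := by
    have hb : (g w₀ : ℂ) - a * w₀ ≠ 0 := sub_ne_zero.2 hw₀
    refine ⟨(1 + (a - 1 - g w₀) * w₀) / (g w₀ - a * w₀),
      (a - g w₀ + a * g w₀ * (1 - w₀)) / (g w₀ - a * w₀), fun z => ?_⟩
    field_simp
    linear_combination hfe z w₀
  have haκ : a * (1 + κ) = 1 + δ := by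
    have h2 := hgz rhpOne
    have h3 : (rhpOne : ℂ) = 1 := rfl
    rwa [h3, mul_one] at h2
  by_cases hμ : 1 - δ * κ = 0
  · left
    have hg' : ∀ z : RHP, (z : ℂ) + κ ≠ 0 → (g z : ℂ) = δ := fun z hz =>
      mul_right_cancel₀ hz (by linear_combination hgz z + hμ)
    have hδ : 0 < δ.re := by
      -- The value δ has to be read off at a point with z + κ ≠ 0; if 1 fails, then 2 works.
      by_cases h2 : (1 : ℂ) + κ = 0
      · have h3 : ((⟨2, by simp⟩ : RHP) : ℂ) + κ ≠ 0 := fun h3 => by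
          have : (1 : ℂ) = 0 := by linear_combination h3 - h2
          exact one_ne_zero this
        rw [← hg' _ h3]
        exact (g _).2
      · rw [← hg' rhpOne h2]
        exact (g _).2
    have hδ0 : δ ≠ 0 := ne_zero_of_mem_rhp hδ
    -- Since δκ = 1, a zero of z + κ would be a zero of 1 + δz, excluded by Re δ > 0.
    have hgδ : ∀ z : RHP, (g z : ℂ) = δ := fun z => hg' z fun h2 =>
      one_add_mul_ne_zero z.2 hδ (by linear_combination δ * h2 + hμ)
    refine ⟨δ, f rhpOne * (1 + δ) ^ (l + 2), hδ, fun w => ⟨hgδ w, ?_⟩⟩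
    have h2 := hf w
    rw [ha, hgδ, hgδ] at h2
    rw [eq_div_iff (pow_ne_zero _ (one_add_mul_ne_zero w.2 hδ)), h2]
  · right; right
    have hne : ∀ z : RHP, (z : ℂ) + κ ≠ 0 := fun z h2 => hμ (by
      linear_combination (g z - δ) * h2 - hgz z)
    -- Otherwise the pole -κ would lie in the half-plane.
    have hκ : 0 ≤ κ.re := by
      by_contra! h2
      exact hne ⟨-κ, by simpa using h2⟩ (by simp)
    have hgf : ∀ z : RHP, (g z : ℂ) = δ + (1 - δ * κ) / (z + κ) := fun z => by
      have := hne z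
      field_simp
      linear_combination hgz z
    refine ⟨δ, κ, f rhpOne * (1 + κ) ^ (l + 2), condIII_of_mapsTo hκ fun z hz => ?_,
      fun w => ⟨hgf w, ?_⟩⟩
    · have := (g ⟨z, hz⟩).2
      rwa [hgf] at this
    · rw [eq_div_iff (pow_ne_zero _ (hne w))]
      apply mul_right_cancel₀ (pow_ne_zero (l + 2) (one_add_mul_ne_zero w.2 hare))
      -- Its (ℓ+2)-th power turns the expression of f through g into the stated form, with r fixed
      -- by the value at w = 1.
      have h2 : (1 + (g w : ℂ)) * (w + κ) = (1 + a * w) * (1 + κ) := by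
        linear_combination hgz w - w * haκ
      calc _ = f w * (1 + a * w) ^ (l + 2) * (w + κ) ^ (l + 2) := by ring
        _ = f rhpOne * ((1 + (g w : ℂ)) * (w + κ)) ^ (l + 2) := by rw [hf, mul_pow]; ring
        _ = _ := by rw [h2, mul_pow]; ring

theorem symbolSymmetry_of_eq_zero {l : ℕ} {f : RHP → ℂ} {g : RHP → RHP} (h : ∀ z, f z = 0) :
    SymbolSymmetry l f g := fun z w => by simp [h]

theorem FormI.symbolSymmetry {l : ℕ} {f : RHP → ℂ} {g : RHP → RHP} (h : FormI l f g) :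
    SymbolSymmetry l f g := by
  obtain ⟨α, β, -, h⟩ := h
  intro z w
  rw [(h z).1, (h z).2, (h w).1, (h w).2, mul_comm (w : ℂ), div_right_comm]

theorem FormII.symbolSymmetry {l : ℕ} {f : RHP → ℂ} {g : RHP → RHP} (h : FormII f g) :
    SymbolSymmetry l f g := by
  obtain ⟨lam, θ, -, h⟩ := h
  intro z w
  rw [(h z).1, (h z).2, (h w).1, (h w).2]
  congr 3
  ring

theorem FormIII.symbolSymmetry {l : ℕ} {f : RHP → ℂ} {g : RHP → RHP} (h : FormIII l f g) :
    SymbolSymmetry l f g := by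
  obtain ⟨δ, κ, r, hc, h⟩ := h
  intro z w
  have hz := add_ne_zero_of_re z.2 hc.re_nonneg
  have hw := add_ne_zero_of_re w.2 hc.re_nonneg
  rw [(h z).1, (h z).2, (h w).1, (h w).2, div_div, div_div, ← mul_pow, ← mul_pow]
  congr 2
  field_simp
  ring

/-! ### The conjugation, kernels and C⋆-selfadjointness. -/

variable {l : ℕ}

theorem reflect_coe (z : RHP) : (reflect z : ℂ) = 1 / conj (z : ℂ) := rfl

theorem reflect_reflect (z : RHP) : reflect (reflect z) = z := by
  apply Subtype.ext
  simp [reflect_coe]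

theorem coe_ne_zero (z : RHP) : (z : ℂ) ≠ 0 := ne_zero_of_mem_rhp z.2

theorem cstar_cstar (h : Bergman l) : cstar l (cstar l h) = h := by
  ext z
  have hz := coe_ne_zero z
  have hz' : conj (z : ℂ) ≠ 0 := (map_ne_zero _).2 hz
  rw [cstar_apply, cstar_apply, reflect_reflect, reflect_coe]
  simp
  field_simp

theorem norm_cstar (h : Bergman l) : ‖cstar l h‖ = ‖h‖ := by
  have h1 : ‖cstar l h‖ₑ ^ 2 = ‖h‖ₑ ^ 2 := by
    rw [← Bergman.lintegral_enorm_sq, ← Bergman.lintegral_enorm_sq]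
    exact lintegral_cstarFun h.analytic
  rw [← ofReal_norm, ← ofReal_norm, ← ENNReal.ofReal_pow (norm_nonneg _),
    ← ENNReal.ofReal_pow (norm_nonneg _), ENNReal.ofReal_eq_ofReal_iff (by positivity)
      (by positivity)] at h1
  exact (pow_left_inj₀ (norm_nonneg _) (norm_nonneg _) two_ne_zero).1 h1

/-- Polarisation of `norm_cstar`: antilinearity changes the sign of i, which interchanges the two
imaginary terms and so swaps the arguments. -/
theorem inner_cstar_cstar (h k : Bergman l) : ⟪cstar l h, cstar l k⟫_ℂ = ⟪k, h⟫_ℂ := by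
  have hs : Complex.I • cstar l k = -cstar l (Complex.I • k) := by
    rw [map_smulₛₗ, Complex.conj_I, neg_smul, neg_neg]
  rw [← inner_conj_symm k h, inner_eq_sum_norm_sq_div_four (cstar l h),
    inner_eq_sum_norm_sq_div_four h]
  simp only [RCLike.I_to_complex]
  rw [hs, ← sub_eq_add_neg, sub_neg_eq_add, ← map_add, ← map_sub, ← map_add, ← map_sub]
  have h4 : conj (4 : ℂ) = 4 := map_ofNat _ 4
  simp only [norm_cstar]
  simp [h4]
  ring

theorem cstar_kernel_apply (w z : RHP) :
    cstar l (kernel l w) z = 1 / (1 + (w : ℂ) * z) ^ (l + 2) := by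
  have hz := coe_ne_zero z
  rw [cstar_apply, kernel_apply, reflect_coe]
  simp only [map_div₀, map_one, map_pow, map_add, Complex.conj_conj]
  rw [one_div_mul_one_div, ← mul_pow]
  congr 2
  field_simp

/-- Up to a scalar, C⋆ permutes the kernels. This gives both point evaluation at 1/conj z and a
function on which the symbol equation describes the action of the operator. -/
theorem kernel_reflect (z : RHP) :
    kernel l (reflect z) = (z : ℂ) ^ (l + 2) • cstar l (kernel l z) := by
  ext v
  have hz := coe_ne_zero z
  have h1 := one_add_mul_ne_zero v.2 z.2
  have h2 : (v : ℂ) + conj (reflect z : ℂ) = (1 + z * v) / z := by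
    rw [reflect_coe]
    simp
    field_simp
    ring
  rw [kernel_apply, h2, Bergman.smul_apply, cstar_kernel_apply, div_pow, one_div_div, mul_one_div]

theorem maxOp_apply {f : RHP → ℂ} {g : RHP → RHP} (h : (maxOp l f g).domain) (z : RHP) :
    maxOp l f g h z = f z * (h : Bergman l) (g z) := rfl

theorem mem_maxOp_domain {f : RHP → ℂ} {g : RHP → RHP} {h : Bergman l} :
    h ∈ (maxOp l f g).domain ↔ (fun z => f z * h (g z)) ∈ bergmanSubmodule l := Iff.rfl

theorem apply_of_le_maxOp {f : RHP → ℂ} {g : RHP → RHP} {W : Bergman l →ₗ.[ℂ] Bergman l}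
    (hW : W ≤ maxOp l f g) (h : W.domain) (z : RHP) : W h z = f z * (h : Bergman l) (g z) := by
  rw [hW.2 (y := ⟨h, hW.1 h.2⟩) rfl, maxOp_apply]

/-- The adjoint of a weighted composition operator acts on kernels by
`W* k_w = conj (f w) k_{g w}`. -/
theorem inner_kernel_of_le_maxOp {f : RHP → ℂ} {g : RHP → RHP} {W : Bergman l →ₗ.[ℂ] Bergman l}
    (hW : W ≤ maxOp l f g) (w : RHP) (h : W.domain) :
    ⟪conj (f w) • kernel l (g w), (h : Bergman l)⟫_ℂ = ⟪kernel l w, W h⟫_ℂ := by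
  rw [inner_smul_left, inner_kernel, inner_kernel, apply_of_le_maxOp hW, Complex.conj_conj]
  ring

/-- The kernels always lie in the domain of W*, so the equality of domains puts C⋆ k_w into the
domain of W. The equation compares the two ways of computing W C⋆ k_w at z. -/
theorem symbolSymmetry_of_isCstarSelfadjoint {f : RHP → ℂ} {g : RHP → RHP}
    {W : Bergman l →ₗ.[ℂ] Bergman l} (hW : W ≤ maxOp l f g) (hs : IsCstarSelfadjoint W) :
    SymbolSymmetry l f g := by
  obtain ⟨hd, he⟩ := hs
  intro z w
  have h1 : kernel l w ∈ W.adjoint.domain :=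
    LinearPMap.mem_adjoint_domain_of_exists _ ⟨_, inner_kernel_of_le_maxOp hW w⟩
  have h2 : W.adjoint ⟨kernel l w, h1⟩ = conj (f w) • kernel l (g w) :=
    LinearPMap.adjoint_apply_eq hd _ (inner_kernel_of_le_maxOp hW w)
  have h3 : cstar l (kernel l w) ∈ (conjugate (cstar l) W.adjoint).domain := by
    change cstar l (cstar l (kernel l w)) ∈ W.adjoint.domain
    rwa [cstar_cstar]
  have h4 : conjugate (cstar l) W.adjoint ⟨cstar l (kernel l w), h3⟩
      = f w • cstar l (kernel l (g w)) := by
    change cstar l (W.adjoint ⟨cstar l (cstar l (kernel l w)), h3⟩) = _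
    have : (⟨cstar l (cstar l (kernel l w)), h3⟩ : W.adjoint.domain) = ⟨kernel l w, h1⟩ :=
      Subtype.ext (cstar_cstar _)
    rw [this, h2, map_smulₛₗ, Complex.conj_conj]
  have h5 := apply_of_le_maxOp (he.ge.trans hW) ⟨cstar l (kernel l w), h3⟩ z
  rw [h4, Bergman.smul_apply, cstar_kernel_apply, cstar_kernel_apply, mul_one_div,
    mul_one_div] at h5
  exact h5.symm

/-- Boundedness makes both domains the whole space, so only the values need comparing. Pairing T* C⋆
x with the kernel at 1/conj z moves T onto that kernel, where the symbol equation gives z^(ℓ+2) f(z)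
C⋆ k_{g z}; the reproducing property then produces f(z) x(g z). -/
theorem isCstarSelfadjoint_maxOp {f : RHP → ℂ} {g : RHP → RHP} (hb : IsBoundedOp (maxOp l f g))
    (hs : SymbolSymmetry l f g) : IsCstarSelfadjoint (maxOp l f g) := by
  obtain ⟨htop, L, hL, hbd⟩ := hb
  set T := maxOp l f g with hT
  have hd : Dense (T.domain : Set (Bergman l)) := by
    rw [htop]
    exact dense_univ
  have hcont : Continuous T.toFun := AddMonoidHomClass.continuous_of_bound T.toFun L hbd
  have hadj : ∀ y, y ∈ T.adjoint.domain := fun y => by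
    rw [LinearPMap.mem_adjoint_domain_iff]
    exact (innerSL ℂ y).continuous.comp hcont
  refine ⟨hd, LinearPMap.ext (Submodule.ext fun x => ?_) fun x hx hx' => ?_⟩
  · rw [htop]
    exact ⟨fun _ => hadj _, fun _ => trivial⟩
  · ext z
    change T ⟨x, hx⟩ z = cstar l (T.adjoint ⟨cstar l x, _⟩) z
    have hz := pow_ne_zero (l + 2) (coe_ne_zero z)
    have h1 : kernel l (reflect z) ∈ T.domain := by
      rw [htop]
      trivial
    have h2 : T ⟨kernel l (reflect z), h1⟩
        = ((z : ℂ) ^ (l + 2) * f z) • cstar l (kernel l (g z)) := by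
      ext v
      rw [apply_of_le_maxOp hT.le]
      simp only
      rw [kernel_reflect, Bergman.smul_apply, Bergman.smul_apply, cstar_kernel_apply,
        cstar_kernel_apply]
      have := hs v z
      rw [div_eq_mul_one_div, div_eq_mul_one_div (f z)] at this
      linear_combination (z : ℂ) ^ (l + 2) * this
    have h3 := LinearPMap.adjoint_isFormalAdjoint hd ⟨cstar l x, hadj _⟩
      ⟨kernel l (reflect z), h1⟩
    rw [h2, inner_smul_right, inner_cstar_cstar, inner_kernel, ← inner_conj_symm, inner_kernel,
      map_mul, Complex.conj_ofReal] at h3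
    have h4 : conj (T.adjoint ⟨cstar l x, hadj _⟩ (reflect z))
        = (z : ℂ) ^ (l + 2) * f z * x (g z) := by
      apply mul_left_cancel₀ (kernelConst_ne_zero l)
      linear_combination h3
    rw [cstar_apply, h4, apply_of_le_maxOp hT.le]
    field_simp

/-- `C⋆`-selfadjoint operators have no proper `C⋆`-selfadjoint extensions. -/
theorem eq_of_le_of_isCstarSelfadjoint {W T : Bergman l →ₗ.[ℂ] Bergman l} (h : W ≤ T)
    (hW : IsCstarSelfadjoint W) (hT : IsCstarSelfadjoint T) : W = T := by
  refine le_antisymm h ?_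
  have h1 : T.adjoint ≤ W.adjoint := LinearPMap.IsFormalAdjoint.le_adjoint hW.1 fun x y => by
    rw [h.2 (y := ⟨x, h.1 x.2⟩) rfl]
    exact (LinearPMap.adjoint_isFormalAdjoint hT.1).symm ⟨x, h.1 x.2⟩ y
  rw [hT.2, hW.2]
  refine ⟨fun x hx => h1.1 hx, fun x y hxy => ?_⟩
  change cstar l (T.adjoint ⟨cstar l x, _⟩) = cstar l (W.adjoint ⟨cstar l y, _⟩)
  rw [h1.2 (y := ⟨cstar l y, y.2⟩) (by simp [hxy])]

/-! ### Boundedness of the three forms. -/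

theorem isBoundedOp_maxOp_of_exists {f : RHP → ℂ} {g : RHP → RHP} (L : ℝ)
    (H : ∀ h : Bergman l, ∃ k : Bergman l, (∀ z, k z = f z * h (g z)) ∧ ‖k‖ ≤ L * ‖h‖) :
    IsBoundedOp (maxOp l f g) := by
  -- The bound in `IsBoundedOp` must be strictly positive, whereas L may be 0.
  refine ⟨Submodule.eq_top_iff'.2 fun h => ?_, max L 1, by positivity, fun h => ?_⟩
  · obtain ⟨k, hk, -⟩ := H h
    rw [mem_maxOp_domain, ← funext hk]
    exact k.2
  · obtain ⟨k, hk, hkL⟩ := H h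
    have : maxOp l f g h = k := by
      ext z
      rw [maxOp_apply, hk]
    rw [this]
    refine hkL.trans ?_
    gcongr
    exact le_max_left _ _

theorem IsAnalytic.mul_comp {f h : RHP → ℂ} {g : RHP → RHP} (hf : IsAnalytic f)
    (hg : IsAnalytic fun z => (g z : ℂ)) (hh : IsAnalytic h) :
    IsAnalytic fun z => f z * h (g z) := by
  obtain ⟨F, hF, ef⟩ := hf
  obtain ⟨G, hG, eg⟩ := hg
  obtain ⟨H, hH, eh⟩ := hh
  have eg' : ∀ z, (g z : ℂ) = G z := eg
  refine ⟨fun z => F z * H (G z), fun z hz => ?_, fun z => by simp only [ef, eh, eg']⟩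
  refine (hF z hz).mul (AnalyticAt.comp (hH _ ?_) (hG z hz))
  rw [← eg' ⟨z, hz⟩]
  exact (g _).2

/-- A change of variables criterion for boundedness of weighted composition operators. -/
theorem isBoundedOp_maxOp_of_injOn {f : RHP → ℂ} {g : RHP → RHP} (hf : IsAnalytic f)
    (hg : IsAnalytic fun z => (g z : ℂ)) {G G' : ℂ → ℂ} (hgG : ∀ z : RHP, (g z : ℂ) = G z)
    (hG : ∀ z ∈ rhp, HasDerivAt G (G' z) z) (hi : InjOn G rhp) {C : ℝ} (hC0 : 0 ≤ C)
    (hC : ∀ z : RHP, (z : ℂ).re ^ l * ‖f z‖ ^ 2 ≤ C * ((g z : ℂ).re ^ l * ‖G' z‖ ^ 2)) :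
    IsBoundedOp (maxOp l f g) := by
  refine isBoundedOp_maxOp_of_exists √C fun h => ?_
  have hpi := Real.pi_pos
  have ha : IsAnalytic fun z => f z * h (g z) := hf.mul_comp hg h.analytic
  have hle : ∫⁻ z, ‖f z * h (g z)‖ₑ ^ 2 ∂(bergmanMeasure l) ≤ ENNReal.ofReal C * ‖h‖ₑ ^ 2 := by
    obtain ⟨F, -, ef⟩ := hf
    obtain ⟨H, -, eh⟩ := h.analytic
    have hmem : ∀ z ∈ rhp, 0 < (G z).re := fun z hz => by
      rw [← hgG ⟨z, hz⟩]
      exact (g _).2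
    rw [← Bergman.lintegral_enorm_sq]
    simp only [ef, eh, hgG]
    rw [lintegral_bergmanMeasure l (fun z => ‖F z * H (G z)‖ₑ ^ 2),
      lintegral_bergmanMeasure l (fun z => ‖H z‖ₑ ^ 2)]
    calc _ ≤ ∫⁻ z in rhp, ENNReal.ofReal C * (ENNReal.ofReal (‖G' z‖ ^ 2) *
          (ENNReal.ofReal ((G z).re ^ l / Real.pi) * ‖H (G z)‖ₑ ^ 2)) := by
          refine setLIntegral_mono' isOpen_rhp.measurableSet fun z hz => ?_
          have h1 := hC ⟨z, hz⟩
          rw [ef, hgG] at h1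
          simp only at h1
          have hz' : 0 < z.re := hz
          have h2 := hmem z hz
          rw [enorm_mul, mul_pow, ← ofReal_norm (F z), ← ENNReal.ofReal_pow (norm_nonneg _),
            ← mul_assoc, ← ENNReal.ofReal_mul (by positivity),
            ← mul_assoc (ENNReal.ofReal (‖G' z‖ ^ 2)), ← ENNReal.ofReal_mul (by positivity),
            ← mul_assoc, ← ENNReal.ofReal_mul hC0]
          gcongr ENNReal.ofReal ?_ * _
          calc _ = z.re ^ l * ‖F z‖ ^ 2 / Real.pi := by ring
            _ ≤ C * ((G z).re ^ l * ‖G' z‖ ^ 2) / Real.pi := by gcongr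
            _ = _ := by ring
      _ = ENNReal.ofReal C * ∫⁻ z in G '' rhp,
          ENNReal.ofReal (z.re ^ l / Real.pi) * ‖H z‖ₑ ^ 2 := by
          rw [lintegral_const_mul' _ _ ENNReal.ofReal_ne_top,
            lintegral_image_holomorphic measurableSet_rhp hG hi]
      _ ≤ _ := by
          gcongr
          exact image_subset_iff.2 hmem
  have hmem : (fun z => f z * h (g z)) ∈ bergmanSubmodule l := by
    refine ⟨ha, (memLp_two_iff ha.continuous l).2 (hle.trans_lt ?_)⟩
    finiteness
  refine ⟨Bergman.mk _ hmem, fun z => rfl, ?_⟩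
  have h1 : ‖Bergman.mk _ hmem‖ₑ ^ 2 ≤ ENNReal.ofReal C * ‖h‖ₑ ^ 2 := by
    rw [← Bergman.lintegral_enorm_sq (Bergman.mk _ hmem)]
    exact hle
  rw [← ofReal_norm, ← ofReal_norm, ← ENNReal.ofReal_pow (norm_nonneg _),
    ← ENNReal.ofReal_pow (norm_nonneg _), ← ENNReal.ofReal_mul hC0,
    ENNReal.ofReal_le_ofReal_iff (by positivity)] at h1
  refine le_of_sq_le_sq ?_ (by positivity)
  rwa [mul_pow, Real.sq_sqrt hC0]

theorem isBoundedOp_of_eq_zero {f : RHP → ℂ} {g : RHP → RHP} (h : ∀ z, f z = 0) :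
    IsBoundedOp (maxOp l f g) :=
  isBoundedOp_maxOp_of_exists 0 fun k => ⟨0, fun z => by simp [h], by simp⟩

/-- The operator is k ↦ β k(α) C⋆ k_α, of rank at most one, and point evaluation at α is bounded. -/
theorem FormI.isBoundedOp {f : RHP → ℂ} {g : RHP → RHP} (h : FormI l f g) :
    IsBoundedOp (maxOp l f g) := by
  obtain ⟨α, β, hα, h⟩ := h
  obtain ⟨C, hC⟩ := Bergman.exists_bound l (r := α.re / 4) (by positivity)
  have hg : ∀ z, g z = ⟨α, hα⟩ := fun z => Subtype.ext (h z).1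
  refine isBoundedOp_maxOp_of_exists (C * ‖β‖ * ‖cstar l (kernel l ⟨α, hα⟩)‖) fun k =>
    ⟨(k ⟨α, hα⟩ * β) • cstar l (kernel l ⟨α, hα⟩), fun z => ?_, ?_⟩
  · rw [Bergman.smul_apply, cstar_kernel_apply, (h z).2, hg]
    ring
  · rw [norm_smul, norm_mul]
    have := hC k ⟨α, hα⟩ (by simp only; linarith)
    calc _ ≤ (C * ‖k‖) * ‖β‖ * ‖cstar l (kernel l ⟨α, hα⟩)‖ := by gcongr
      _ = _ := by ring

theorem FormII.isBoundedOp {f : RHP → ℂ} {g : RHP → RHP} (hf : IsAnalytic f)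
    (hg : IsAnalytic fun z => (g z : ℂ)) (h : FormII f g) :
    IsBoundedOp (maxOp l f g) := by
  obtain ⟨lam, θ, hlam, h⟩ := h
  have hlam' : (lam : ℂ) ≠ 0 := by exact_mod_cast hlam.ne'
  refine isBoundedOp_maxOp_of_injOn hf hg (G := fun z => lam * z) (G' := fun _ => lam)
    (C := ‖θ‖ ^ 2 / lam ^ (l + 2)) (fun z => (h z).1)
    (fun z _ => by simpa using (hasDerivAt_id z).const_mul (lam : ℂ))
    (fun z _ w _ hzw => mul_left_cancel₀ hlam' hzw) (by positivity) fun z => le_of_eq ?_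
  rw [(h z).1, (h z).2, Complex.re_ofReal_mul, mul_pow, Complex.norm_real,
    Real.norm_of_nonneg hlam.le]
  field_simp
  ring

/-- The power ℓ of the Schwarz–Pick estimate `CondIII.le_re` is exactly the weight comparison needed
for the change of variables. That needs g injective; the second alternative of `CondIII` also allows
δκ = 1, where g is constant and form I takes over. -/
theorem FormIII.isBoundedOp {f : RHP → ℂ} {g : RHP → RHP} (hf : IsAnalytic f)
    (hg : IsAnalytic fun z => (g z : ℂ)) (h : FormIII l f g) :
    IsBoundedOp (maxOp l f g) := by
  obtain ⟨δ, κ, r, hc, h⟩ := h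
  have hne : ∀ {z : ℂ}, z ∈ rhp → z + κ ≠ 0 := fun hz => add_ne_zero_of_re hz hc.re_nonneg
  by_cases hμ : 1 - δ * κ = 0
  · have hδ : ∀ z, (g z : ℂ) = δ := fun z => by rw [(h z).1, hμ, zero_div, add_zero]
    have hδ0 : 0 < δ.re := by
      rw [← hδ rhpOne]
      exact (g _).2
    refine FormI.isBoundedOp ⟨δ, r * δ ^ (l + 2), hδ0, fun w => ⟨hδ w, ?_⟩⟩
    have hd : δ ≠ 0 := ne_zero_of_mem_rhp hδ0
    have h1 : 1 + δ * w = δ * (w + κ) := by linear_combination hμ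
    rw [(h w).2, h1, mul_pow, mul_comm r, mul_div_mul_left _ _ (pow_ne_zero _ hd)]
  · have hμ' := norm_pos_iff.2 hμ
    refine isBoundedOp_maxOp_of_injOn hf hg (G := fun z => δ + (1 - δ * κ) / (z + κ))
      (G' := fun z => -(1 - δ * κ) / (z + κ) ^ 2) (C := ‖r‖ ^ 2 / ‖1 - δ * κ‖ ^ (l + 2))
      (fun z => (h z).1) (fun z hz => ?_) (fun z hz w hw hzw => ?_) (by positivity) fun z => ?_
    · have h1 := ((hasDerivAt_const z (1 - δ * κ)).div ((hasDerivAt_id z).add_const κ)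
        (hne hz)).const_add δ
      convert! h1 using 1
      simp
    · have h1 := hne hz
      have h2 := hne hw
      have h3 := add_left_cancel hzw
      rw [div_eq_div_iff h1 h2] at h3
      exact (add_right_cancel (mul_left_cancel₀ hμ h3)).symm
    · have h1 := norm_pos_iff.2 (hne z.2)
      have h2 := hc.le_re z.2
      rw [← (h z).1] at h2
      have hz : 0 < (z : ℂ).re := z.2
      have h3 : (‖1 - δ * κ‖ * (z : ℂ).re) ^ l ≤ ((g z : ℂ).re * ‖(z : ℂ) + κ‖ ^ 2) ^ l := by
        gcongr
      rw [(h z).2, norm_div, norm_div, norm_neg, norm_pow, norm_pow]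
      generalize ‖1 - δ * κ‖ = M at *
      calc _ = (M * (z : ℂ).re) ^ l * (‖r‖ ^ 2 / (M ^ l *
            (‖(z : ℂ) + κ‖ ^ (l + 2)) ^ 2)) := by
            rw [mul_pow]
            field_simp
        _ ≤ ((g z : ℂ).re * ‖(z : ℂ) + κ‖ ^ 2) ^ l * (‖r‖ ^ 2 / (M ^ l *
            (‖(z : ℂ) + κ‖ ^ (l + 2)) ^ 2)) := by gcongr
        _ = _ := by
            field_simp
            ring

end HalfPlane
end

open HalfPlane
theorem mainTheorem7 (l : ℕ) (f : RHP → ℂ) (g : RHP → RHP)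
    (hf : IsAnalytic f) (hg : IsAnalytic fun z => (g z : ℂ))
    (W : Bergman l →ₗ.[ℂ] Bergman l) (hW : W ≤ maxOp l f g) :
    (IsCstarSelfadjoint W ↔
      W = maxOp l f g ∧
        ((∀ z, f z = 0) ∨ FormI l f g ∨ FormII f g ∨ FormIII l f g)) ∧
    (IsCstarSelfadjoint W → IsBoundedOp W) := by
  have key : ((∀ z, f z = 0) ∨ FormI l f g ∨ FormII f g ∨ FormIII l f g) →
      SymbolSymmetry l f g ∧ IsBoundedOp (maxOp l f g) := by
    rintro (h | h | h | h)
    · exact ⟨symbolSymmetry_of_eq_zero h, isBoundedOp_of_eq_zero h⟩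
    · exact ⟨h.symbolSymmetry, h.isBoundedOp⟩
    · exact ⟨h.symbolSymmetry, h.isBoundedOp hf hg⟩
    · exact ⟨h.symbolSymmetry, h.isBoundedOp hf hg⟩
  have forms : IsCstarSelfadjoint W → W = maxOp l f g ∧
      ((∀ z, f z = 0) ∨ FormI l f g ∨ FormII f g ∨ FormIII l f g) := fun h => by
    have h1 := (symbolSymmetry_of_isCstarSelfadjoint hW h).forms hg.continuous
    obtain ⟨h2, h3⟩ := key h1
    -- The forms found for W make the maximal operator C⋆-selfadjoint as well, which forces W to be
    -- maximal.
    exact ⟨eq_of_le_of_isCstarSelfadjoint hW h (isCstarSelfadjoint_maxOp h3 h2), h1⟩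
  refine ⟨⟨forms, fun ⟨h1, h2⟩ => ?_⟩, fun h => ?_⟩
  · rw [h1]
    exact isCstarSelfadjoint_maxOp (key h2).2 (key h2).1
  · rw [(forms h).1]
    exact (key (forms h).2).2
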